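/- All manifolds are real, finite-dimensional, Hausdorff, second countable and $C^\infty$, and all maps, sections, forms and distributions are $C^\infty$. **Setting.** Let $M$ be an $m$-dimensional manifold with a volume form $\eta$, let $\pi\colon E\to M$ be a smooth bundle (a surjective submersion, for instance any fibre bundle) with $\dim E=m+n$, and let $J^1\pi$ be its first-order jet bundle, with projections $\pi^1\colon J^1\pi\to E$, $j^1_x\phi\mapsto\phi(x)$, and $\bar\pi^1=\pi\circ\pi^1\colon J^1\pi\to M$. Write $\Gamma(\cdot)$ for local sections over open subsets of the base. Let $\mathcal L=L\,(\bar\pi^1)^*\eta$, with $L\in C^\infty(J^1\pi)$, be a regular Lagrangian density, i.e. the Hessian of $L$ restricted to each affine fibre of $\pi^1$, with matrix $\bigl(\partial^2L/\partial u^\alpha_i\partial u^\beta_j\bigr)$, is nondegenerate. Let $\Theta_{\mathcal L}=i(\nu)\,\mathrm d\mathcal L+\mathcal L$ be the Cartan $m$-form, $\nu$ being the canonical vertical endomorphism of $J^1\pi$, and $\Omega_{\mathcal L}=-\mathrm d\Theta_{\mathcal L}$; in coordinates $(x^i,u^\alpha,u^\alpha_i)$ with $\eta=\mathrm d^mx$,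 $$\Theta_{\mathcal L}=\frac{\partial L}{\partial u^\alpha_i}\,\mathrm du^\alpha\wedge\mathrm d^{m-1}x_i-\Bigl(\frac{\partial L}{\partial u^\alpha_i}u^\alpha_i-L\Bigr)\mathrm d^mx,\qquad \mathrm d^{m-1}x_i=i(\partial/\partial x^i)\,\mathrm d^mx .$$ A section $s$ is an *integral section* of a distribution $\mathcal D$ if $T_q\,\mathrm{Im}(s)=\mathcal D_q$ for every $q\in\mathrm{Im}(s)$; a distribution transverse to the fibres is *integrable* if there is an integral section through every point. Let $\mathcal D_{\mathcal L}$ be a solution of the Lagrangian problem: an $m$-dimensional, $\bar\pi^1$-transverse, integrable distribution in $J^1\pi$ whose integral sections are prolongations $j^1\phi$ of sections $\phi\in\Gamma(\pi)$ with $(j^1\phi)^*\,i(X)\,\Omega_{\mathcal L}=0$ for every vector field $X$ on $J^1\pi$. A *jet field* is a global section $\Psi\colon E\to J^1\pi$ of $\pi^1$. It is *integrable* if the associated distribution $\mathcal D(\Psi)$ in $E$, $\mathcal D(\Psi)_u=T_x\phi(T_xM)$ for $\Psi(u)=j^1_x\phi$, is integrable. Let $T\pi^1(\mathcal D_{\mathcal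 L}|_{\mathrm{Im}(\Psi)})$ be the distribution in $E$ given at $u\in E$ by $T\pi^1\bigl((\mathcal D_{\mathcal L})_{\Psi(u)}\bigr)$. An integrable jet field $\Psi$ is a *solution of the generalized Lagrangian Hamilton–Jacobi problem* if $T\pi^1(\mathcal D_{\mathcal L}|_{\mathrm{Im}(\Psi)})$ is an $m$-dimensional integrable distribution and, for each of its integral sections $\gamma\in\Gamma(\pi)$, $\Psi\circ\gamma$ is an integral section of $\mathcal D_{\mathcal L}$. It is a *solution of the Lagrangian Hamilton–Jacobi problem* if moreover $\Psi^*\Omega_{\mathcal L}=0$. The submanifold $\mathrm{Im}(\Psi)\hookrightarrow J^1\pi$ is *$m$-Lagrangian* if, for every $\bar u\in\mathrm{Im}(\Psi)$ and $F=T_{\bar u}\mathrm{Im}(\Psi)$, $$F=\{w\in T_{\bar u}J^1\pi:\ (\Omega_{\mathcal L})_{\bar u}(w,v_1,\dots,v_m)=0\ \text{ for all } v_1,\dots,v_m\in F\}.$$ **Proposition.** Let $\Psi$ be an integrable jet field with $\Psi^*\Omega_{\mathcal L}=0$. Then the following statements are equivalent: 1. $\Psi$ is a solution of the Lagrangian Hamilton–Jacobi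 problem. 2. The submanifold $\mathrm{Im}(\Psi)\hookrightarrow J^1\pi$ is $m$-Lagrangian and $\mathcal D_{\mathcal L}$ is tangent to it, that is, $(\mathcal D_{\mathcal L})_{\bar u}\subseteq T_{\bar u}\mathrm{Im}(\Psi)$ for every $\bar u\in\mathrm{Im}(\Psi)$. 3. The integral sections of $\mathcal D_{\mathcal L}$ with boundary conditions in $\mathrm{Im}(\Psi)$ project onto the integral sections of $T\pi^1(\mathcal D_{\mathcal L}|_{\mathrm{Im}(\Psi)})$: for every integral section $\psi$ of $\mathcal D_{\mathcal L}$ on a connected open set $U$ with $\psi(x)\in\mathrm{Im}(\Psi)$ for some $x\in U$, $\pi^1\circ\psi$ is an integral section of $T\pi^1(\mathcal D_{\mathcal L}|_{\mathrm{Im}(\Psi)})$, and every integral section of the latter on a nonempty connected open set arises in this way. -/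

import Mathlib

set_option maxSynthPendingDepth 3

open scoped Manifold ContDiff Topology

noncomputable section

section FirstJetBundle

variable {B F M E : Type*}
  [NormedAddCommGroup B] [NormedSpace ℝ B]
  [NormedAddCommGroup F] [NormedSpace ℝ F]
  [TopologicalSpace M] [ChartedSpace B M]
  [TopologicalSpace E] [ChartedSpace (B × F) E]

variable (B F M E) in
/-- A smooth bundle `proj : E → M` over a manifold `M` modelled on `B`, whose total space `E` is
modelled on `B × F`: a surjective submersion. (Every smooth locally trivial fibre bundle whose
fibres are modelled on `F` is one.) -/
structure SmoothBundle where
  proj : E → M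
  surjective : Function.Surjective proj
  submersion : ∀ u : E, Manifold.IsSubmersionAtOfComplement F 𝓘(ℝ, B × F) 𝓘(ℝ, B) ∞ proj u

/-- Local coordinates `(x, u)` on `E`, adapted to the bundle: a chart of `M` and a chart of `E`
in which the projection reads `(x, u) ↦ x`. -/
structure AdaptedChart (π : SmoothBundle B F M E) where
  base : OpenPartialHomeomorph M B
  tot : OpenPartialHomeomorph E (B × F)
  base_mem : base ∈ IsManifold.maximalAtlas 𝓘(ℝ, B) ∞ M
  tot_mem : tot ∈ IsManifold.maximalAtlas 𝓘(ℝ, B × F) ∞ E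
  proj_mem : ∀ u ∈ tot.source, π.proj u ∈ base.source
  base_proj : ∀ u ∈ tot.source, base (π.proj u) = (tot u).1

theorem SmoothBundle.contMDiff (π : SmoothBundle B F M E)
    [IsManifold 𝓘(ℝ, B) ∞ M] [IsManifold 𝓘(ℝ, B × F) ∞ E] :
    ContMDiff 𝓘(ℝ, B × F) 𝓘(ℝ, B) ∞ π.proj := fun u => (π.submersion u).contMDiffAt

theorem SmoothBundle.mdifferentiableAt (π : SmoothBundle B F M E)
    [IsManifold 𝓘(ℝ, B) ∞ M] [IsManifold 𝓘(ℝ, B × F) ∞ E] (u : E) :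
    MDifferentiableAt 𝓘(ℝ, B × F) 𝓘(ℝ, B) π.proj u :=
  (π.contMDiff u).mdifferentiableAt (by simp)

theorem SmoothBundle.exists_adaptedChart (π : SmoothBundle B F M E)
    [IsManifold 𝓘(ℝ, B × F) ∞ E] (u : E) :
    ∃ A : AdaptedChart π, u ∈ A.tot.source := by
  have h := π.submersion u
  let e : OpenPartialHomeomorph (B × F) (B × F) := h.equiv.toHomeomorph.toOpenPartialHomeomorph
  refine ⟨⟨h.codChart, h.domChart.trans e, h.codChart_mem_maximalAtlas, ?_, ?_, ?_⟩, ?_⟩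
  · apply OpenPartialHomeomorph.mem_maximalAtlas_of_contMDiffOn
    · have h1 : ContMDiff 𝓘(ℝ, B × F) 𝓘(ℝ, B × F) ∞ h.equiv := h.equiv.contDiff.contMDiff
      have h2 := contMDiffOn_of_mem_maximalAtlas h.domChart_mem_maximalAtlas
      exact (h1.comp_contMDiffOn h2).mono (by intro x hx; simpa [e] using hx)
    · have h1 : ContMDiff 𝓘(ℝ, B × F) 𝓘(ℝ, B × F) ∞ h.equiv.symm :=
        h.equiv.symm.contDiff.contMDiff
      have h2 := contMDiffOn_symm_of_mem_maximalAtlas h.domChart_mem_maximalAtlas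
      exact h2.comp h1.contMDiffOn (by intro x hx; simpa [e] using hx)
  · intro v hv
    exact h.source_subset_preimage_source (by simpa [e] using hv)
  · intro v hv
    have hv' : v ∈ h.domChart.source := by simpa [e] using hv
    have hm : h.domChart v ∈ (h.domChart.extend 𝓘(ℝ, B × F)).target := by simp [hv']
    have := h.writtenInCharts hm
    simpa [e, hv'] using this
  · simpa [e] using h.mem_domChart_source

/-- A point of the first-order jet bundle `J¹π`. The 1-jet `j¹ₓφ` of a local section `φ` is given by
the point `φ x` and the tangent map `Tₓφ : TₓM → T_{φ x}E`; the maps that arise in this way are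
exactly the linear sections of `Tπ : T_{φ x}E → TₓM`. -/
structure FirstJet (π : SmoothBundle B F M E) where
  pt : E
  hor : TangentSpace 𝓘(ℝ, B) (π.proj pt) →L[ℝ] TangentSpace 𝓘(ℝ, B × F) pt
  mfderiv_hor : ∀ v, mfderiv 𝓘(ℝ, B × F) 𝓘(ℝ, B) π.proj pt (hor v) = v

namespace FirstJet

variable {π : SmoothBundle B F M E}

theorem ext_of_eq {j j' : FirstJet π} (h : j.pt = j'.pt)
    (h' : (j.hor : B →L[ℝ] B × F) = (j'.hor : B →L[ℝ] B × F)) : j = j' := by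
  obtain ⟨p, H, hH⟩ := j
  obtain ⟨p', H', hH'⟩ := j'
  obtain rfl : p = p' := h
  obtain rfl : H = H' := h'
  rfl

end FirstJet

namespace AdaptedChart

variable {π : SmoothBundle B F M E}

theorem mdiff_tot (A : AdaptedChart π) {u : E} (hu : u ∈ A.tot.source) :
    MDifferentiableAt 𝓘(ℝ, B × F) 𝓘(ℝ, B × F) A.tot u :=
  (contMDiffAt_of_mem_maximalAtlas A.tot_mem hu).mdifferentiableAt (by simp)

theorem mdiff_tot_symm (A : AdaptedChart π) {y : B × F} (hy : y ∈ A.tot.target) :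
    MDifferentiableAt 𝓘(ℝ, B × F) 𝓘(ℝ, B × F) A.tot.symm y :=
  (contMDiffAt_symm_of_mem_maximalAtlas A.tot_mem hy).mdifferentiableAt (by simp)

theorem mdiff_base (A : AdaptedChart π) {x : M} (hx : x ∈ A.base.source) :
    MDifferentiableAt 𝓘(ℝ, B) 𝓘(ℝ, B) A.base x :=
  (contMDiffAt_of_mem_maximalAtlas A.base_mem hx).mdifferentiableAt (by simp)

theorem mdiff_base_symm (A : AdaptedChart π) {y : B} (hy : y ∈ A.base.target) :
    MDifferentiableAt 𝓘(ℝ, B) 𝓘(ℝ, B) A.base.symm y :=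
  (contMDiffAt_symm_of_mem_maximalAtlas A.base_mem hy).mdifferentiableAt (by simp)

/-- The tangent map of the total chart. -/
def dTot (A : AdaptedChart π) (u : E) : (B × F) →L[ℝ] (B × F) :=
  mfderiv 𝓘(ℝ, B × F) 𝓘(ℝ, B × F) A.tot u

/-- The tangent map of the inverse of the total chart. -/
def dTotSymm (A : AdaptedChart π) (y : B × F) : (B × F) →L[ℝ] (B × F) :=
  mfderiv 𝓘(ℝ, B × F) 𝓘(ℝ, B × F) A.tot.symm y

/-- The tangent map of the base chart. -/
def dBase (A : AdaptedChart π) (x : M) : B →L[ℝ] B :=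
  mfderiv 𝓘(ℝ, B) 𝓘(ℝ, B) A.base x

/-- The tangent map of the inverse of the base chart. -/
def dBaseSymm (A : AdaptedChart π) (y : B) : B →L[ℝ] B :=
  mfderiv 𝓘(ℝ, B) 𝓘(ℝ, B) A.base.symm y

/-- The coordinates `uᵢ^α` of a jet, the derivatives of `u^α`, in adapted coordinates. -/
def velocity (A : AdaptedChart π) (j : FirstJet π) : B →L[ℝ] F :=
  ContinuousLinearMap.snd ℝ B F ∘L A.dTot j.pt ∘L (j.hor : B →L[ℝ] B × F) ∘L
    A.dBaseSymm (A.base (π.proj j.pt))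

/-- The linear map `TₓM → T_uE` whose coordinate expression is `v ↦ (v, p v)`. -/
def horOf (A : AdaptedChart π) (y : B × F) (p : B →L[ℝ] F) : B →L[ℝ] B × F :=
  A.dTotSymm y ∘L (ContinuousLinearMap.id ℝ B).prod p ∘L A.dBase (π.proj (A.tot.symm y))

theorem dBase_comp_dBaseSymm (A A' : AdaptedChart π) {y : B} (hy : y ∈ A.base.target)
    (hy' : A.base.symm y ∈ A'.base.source) :
    A'.dBase (A.base.symm y) ∘L A.dBaseSymm y = fderiv ℝ (A'.base ∘ A.base.symm) y := by
  rw [← mfderiv_eq_fderiv]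
  exact (mfderiv_comp y (A'.mdiff_base hy') (A.mdiff_base_symm hy)).symm

theorem dTot_comp_dTotSymm (A A' : AdaptedChart π) {y : B × F} (hy : y ∈ A.tot.target)
    (hy' : A.tot.symm y ∈ A'.tot.source) :
    A'.dTot (A.tot.symm y) ∘L A.dTotSymm y = fderiv ℝ (A'.tot ∘ A.tot.symm) y := by
  rw [← mfderiv_eq_fderiv]
  exact (mfderiv_comp y (A'.mdiff_tot hy') (A.mdiff_tot_symm hy)).symm

theorem dBase_comp_dBaseSymm_self (A : AdaptedChart π) {y : B} (hy : y ∈ A.base.target) :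
    A.dBase (A.base.symm y) ∘L A.dBaseSymm y = ContinuousLinearMap.id ℝ B := by
  rw [dBase_comp_dBaseSymm A A hy (A.base.map_target hy)]
  have : (A.base ∘ A.base.symm) =ᶠ[𝓝 y] id := by
    filter_upwards [A.base.open_target.mem_nhds hy] with z hz using A.base.right_inv hz
  rw [this.fderiv_eq, fderiv_id]

theorem dTot_comp_dTotSymm_self (A : AdaptedChart π) {y : B × F} (hy : y ∈ A.tot.target) :
    A.dTot (A.tot.symm y) ∘L A.dTotSymm y = ContinuousLinearMap.id ℝ (B × F) := by
  rw [dTot_comp_dTotSymm A A hy (A.tot.map_target hy)]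
  have : (A.tot ∘ A.tot.symm) =ᶠ[𝓝 y] id := by
    filter_upwards [A.tot.open_target.mem_nhds hy] with z hz using A.tot.right_inv hz
  rw [this.fderiv_eq, fderiv_id]

theorem dBaseSymm_comp_dBase_self (A : AdaptedChart π) {x : M} (hx : x ∈ A.base.source) :
    A.dBaseSymm (A.base x) ∘L A.dBase x = ContinuousLinearMap.id ℝ B := by
  have h1 := mfderiv_comp (I := 𝓘(ℝ, B)) (I' := 𝓘(ℝ, B)) (I'' := 𝓘(ℝ, B)) x
    (A.mdiff_base_symm (A.base.map_source hx)) (A.mdiff_base hx)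
  have : (A.base.symm ∘ A.base) =ᶠ[𝓝 x] id := by
    filter_upwards [A.base.open_source.mem_nhds hx] with z hz using A.base.left_inv hz
  rw [this.mfderiv_eq, mfderiv_id] at h1
  exact h1.symm

theorem dTotSymm_comp_dTot_self (A : AdaptedChart π) {u : E} (hu : u ∈ A.tot.source) :
    A.dTotSymm (A.tot u) ∘L A.dTot u = ContinuousLinearMap.id ℝ (B × F) := by
  have h1 := mfderiv_comp (I := 𝓘(ℝ, B × F)) (I' := 𝓘(ℝ, B × F)) (I'' := 𝓘(ℝ, B × F)) u
    (A.mdiff_tot_symm (A.tot.map_source hu)) (A.mdiff_tot hu)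
  have : (A.tot.symm ∘ A.tot) =ᶠ[𝓝 u] id := by
    filter_upwards [A.tot.open_source.mem_nhds hu] with z hz using A.tot.left_inv hz
  rw [this.mfderiv_eq, mfderiv_id] at h1
  exact h1.symm

theorem velocity_of_hor_eq (A : AdaptedChart π) {y : B × F} (hy : y ∈ A.tot.target)
    (p : B →L[ℝ] F) (A' : AdaptedChart π) (hy' : A.tot.symm y ∈ A'.tot.source)
    (j : FirstJet π) (hpt : j.pt = A.tot.symm y) (hhor : (j.hor : B →L[ℝ] B × F) = A.horOf y p) :
    A'.velocity j = ContinuousLinearMap.snd ℝ B F ∘L fderiv ℝ (A'.tot ∘ A.tot.symm) y ∘L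
      (ContinuousLinearMap.id ℝ B).prod p ∘L
        fderiv ℝ (A.base ∘ A'.base.symm) ((A'.tot ∘ A.tot.symm) y).1 := by
  have hus : A.tot.symm y ∈ A.tot.source := A.tot.map_target hy
  have hx := A.proj_mem _ hus
  have hx' := A'.proj_mem _ hy'
  have e1 : A'.base.symm (A'.base (π.proj (A.tot.symm y))) = π.proj (A.tot.symm y) :=
    A'.base.left_inv hx'
  rw [← dTot_comp_dTotSymm A A' hy hy', Function.comp_apply, ← A'.base_proj _ hy',
    ← dBase_comp_dBaseSymm A' A (A'.base.map_source hx') (by rw [e1]; exact hx), e1]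
  unfold velocity
  rw [hhor, hpt]
  rfl

variable [IsManifold 𝓘(ℝ, B) ∞ M] [IsManifold 𝓘(ℝ, B × F) ∞ E]

theorem fst_comp_dTot (A : AdaptedChart π) {u : E} (hu : u ∈ A.tot.source) :
    ContinuousLinearMap.fst ℝ B F ∘L A.dTot u =
      A.dBase (π.proj u) ∘L (mfderiv 𝓘(ℝ, B × F) 𝓘(ℝ, B) π.proj u : B × F →L[ℝ] B) := by
  have h1 := mfderiv_comp (I := 𝓘(ℝ, B × F)) (I' := 𝓘(ℝ, B)) (I'' := 𝓘(ℝ, B)) u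
    (A.mdiff_base (A.proj_mem u hu)) (π.mdifferentiableAt u)
  have hf : MDifferentiableAt 𝓘(ℝ, B × F) 𝓘(ℝ, B) (Prod.fst : B × F → B) (A.tot u) :=
    (ContinuousLinearMap.fst ℝ B F).differentiableAt.mdifferentiableAt
  have h2 := mfderiv_comp (I := 𝓘(ℝ, B × F)) (I' := 𝓘(ℝ, B × F)) (I'' := 𝓘(ℝ, B)) u
    hf (A.mdiff_tot hu)
  have : (A.base ∘ π.proj) =ᶠ[𝓝 u] (Prod.fst ∘ A.tot) := by
    filter_upwards [A.tot.open_source.mem_nhds hu] with z hz using A.base_proj z hz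
  rw [this.mfderiv_eq, h2, mfderiv_eq_fderiv] at h1
  have h3 : fderiv ℝ (Prod.fst : B × F → B) (A.tot u) = ContinuousLinearMap.fst ℝ B F :=
    (ContinuousLinearMap.fst ℝ B F).fderiv
  rw [h3] at h1
  exact h1

theorem proj_horOf (A : AdaptedChart π) {y : B × F} (hy : y ∈ A.tot.target) (p : B →L[ℝ] F)
    (v : B) :
    (mfderiv 𝓘(ℝ, B × F) 𝓘(ℝ, B) π.proj (A.tot.symm y) : B × F →L[ℝ] B) (A.horOf y p v) = v := by
  set u := A.tot.symm y with hu
  have hus : u ∈ A.tot.source := A.tot.map_target hy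
  have hx := A.proj_mem u hus
  have h1 := DFunLike.congr_fun (A.fst_comp_dTot hus) (A.horOf y p v)
  have h2 := DFunLike.congr_fun (A.dTot_comp_dTotSymm_self hy)
    (A.dBase (π.proj u) v, p (A.dBase (π.proj u) v))
  have h3 : A.dTot u (A.horOf y p v) = (A.dBase (π.proj u) v, p (A.dBase (π.proj u) v)) := h2
  have h4 : A.dBase (π.proj u) v = A.dBase (π.proj u)
      ((mfderiv 𝓘(ℝ, B × F) 𝓘(ℝ, B) π.proj u : B × F →L[ℝ] B) (A.horOf y p v)) := by
    have h5 : (A.dTot u (A.horOf y p v)).1 = _ := h1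
    rw [h3] at h5
    exact h5
  have h6 := congrArg (A.dBaseSymm (A.base (π.proj u))) h4
  have h7 := A.dBaseSymm_comp_dBase_self hx
  have h8 : ∀ w, A.dBaseSymm (A.base (π.proj u)) (A.dBase (π.proj u) w) = w :=
    fun w => DFunLike.congr_fun h7 w
  exact ((h8 v).symm.trans (h6.trans (h8 _))).symm

open Classical in
/-- The coordinates `(x, u, uᵢ)` on `J¹π` induced by adapted coordinates `(x, u)` on `E`. -/
def jetCoord (A : AdaptedChart π) (j₀ : FirstJet π) :
    PartialEquiv (FirstJet π) ((B × F) × (B →L[ℝ] F)) where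
  toFun j := (A.tot j.pt, A.velocity j)
  invFun z := if h : z.1 ∈ A.tot.target then
      ⟨A.tot.symm z.1, A.horOf z.1 z.2, A.proj_horOf h z.2⟩ else j₀
  source := {j | j.pt ∈ A.tot.source}
  target := {z | z.1 ∈ A.tot.target}
  map_source' j hj := A.tot.map_source hj
  map_target' z hz := by
    have hz' : z.1 ∈ A.tot.target := hz
    simp [hz']
  left_inv' j hj := by
    have hj' : j.pt ∈ A.tot.source := hj
    have hx := A.proj_mem _ hj'
    rw [dif_pos (A.tot.map_source hj')]
    refine FirstJet.ext_of_eq (A.tot.left_inv hj') ?_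
    change A.horOf (A.tot j.pt) (A.velocity j) = _
    ext1 v
    set b := A.dBase (π.proj j.pt) v with hb
    have h8 : A.dBaseSymm (A.base (π.proj j.pt)) b = v :=
      DFunLike.congr_fun (A.dBaseSymm_comp_dBase_self hx) v
    have h1 : (A.dTot j.pt ((j.hor : B →L[ℝ] B × F) v)).1 = b := by
      have h5 := DFunLike.congr_fun (A.fst_comp_dTot hj') ((j.hor : B →L[ℝ] B × F) v)
      have h6 : (mfderiv 𝓘(ℝ, B × F) 𝓘(ℝ, B) π.proj j.pt : B × F →L[ℝ] B)
          ((j.hor : B →L[ℝ] B × F) v) = v := j.mfderiv_hor v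
      have h7 : (A.dTot j.pt ((j.hor : B →L[ℝ] B × F) v)).1 = A.dBase (π.proj j.pt)
        ((mfderiv 𝓘(ℝ, B × F) 𝓘(ℝ, B) π.proj j.pt : B × F →L[ℝ] B)
          ((j.hor : B →L[ℝ] B × F) v)) := h5
      rw [h7, h6]
    have h2 : A.velocity j b = (A.dTot j.pt ((j.hor : B →L[ℝ] B × F) v)).2 := by
      change (A.dTot j.pt ((j.hor : B →L[ℝ] B × F) (A.dBaseSymm _ b))).2 = _
      rw [h8]
    have h3 : A.horOf (A.tot j.pt) (A.velocity j) v =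
        A.dTotSymm (A.tot j.pt) (b, A.velocity j b) := by
      change A.dTotSymm (A.tot j.pt) (A.dBase (π.proj (A.tot.symm (A.tot j.pt))) v,
        A.velocity j (A.dBase (π.proj (A.tot.symm (A.tot j.pt))) v)) = _
      rw [A.tot.left_inv hj']
    rw [h3, h2, ← h1, Prod.mk.eta]
    exact DFunLike.congr_fun (A.dTotSymm_comp_dTot_self hj') ((j.hor : B →L[ℝ] B × F) v)
  right_inv' z hz := by
    have hz' : z.1 ∈ A.tot.target := hz
    have hus := A.tot.map_target hz'
    have hx := A.proj_mem _ hus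
    rw [dif_pos hz']
    refine Prod.ext (A.tot.right_inv hz') ?_
    change A.velocity _ = z.2
    rw [A.velocity_of_hor_eq hz' z.2 A hus _ rfl rfl, ← dTot_comp_dTotSymm A A hz' hus,
      dTot_comp_dTotSymm_self A hz', Function.comp_apply, ← A.base_proj _ hus]
    have e1 : A.base.symm (A.base (π.proj (A.tot.symm z.1))) = π.proj (A.tot.symm z.1) :=
      A.base.left_inv hx
    rw [← dBase_comp_dBaseSymm A A (A.base.map_source hx) (by rw [e1]; exact hx),
      dBase_comp_dBaseSymm_self A (A.base.map_source hx)]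
    ext v
    rfl

/-- The change of induced coordinates on `J¹π`. -/
def transition (A A' : AdaptedChart π) (z : (B × F) × (B →L[ℝ] F)) :
    (B × F) × (B →L[ℝ] F) :=
  ((A'.tot ∘ A.tot.symm) z.1, ContinuousLinearMap.snd ℝ B F ∘L
    fderiv ℝ (A'.tot ∘ A.tot.symm) z.1 ∘L (ContinuousLinearMap.id ℝ B).prod z.2 ∘L
      fderiv ℝ (A.base ∘ A'.base.symm) ((A'.tot ∘ A.tot.symm) z.1).1)

theorem jetCoord_trans_source (A A' : AdaptedChart π) (j₀ j₀' : FirstJet π) :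
    ((A.jetCoord j₀).symm.trans (A'.jetCoord j₀')).source =
      {z | z.1 ∈ (A.tot.symm.trans A'.tot).source} := by
  ext z
  by_cases hz : z.1 ∈ A.tot.target
  · simp [jetCoord, PartialEquiv.trans_source, hz]
  · simp [jetCoord, PartialEquiv.trans_source, hz]

theorem jetCoord_trans_eqOn (A A' : AdaptedChart π) (j₀ j₀' : FirstJet π) :
    Set.EqOn ((A.jetCoord j₀).symm.trans (A'.jetCoord j₀')) (transition A A')
      {z | z.1 ∈ (A.tot.symm.trans A'.tot).source} := by
  intro z hz
  have hz1 : z.1 ∈ A.tot.target := by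
    have := hz; simp at this; exact this.1
  have hz2 : A.tot.symm z.1 ∈ A'.tot.source := by
    have := hz; simp at this; exact this.2
  have e : ((A.jetCoord j₀).symm z) =
      ⟨A.tot.symm z.1, A.horOf z.1 z.2, A.proj_horOf hz1 z.2⟩ := dif_pos hz1
  rw [PartialEquiv.coe_trans, Function.comp_apply, e]
  refine Prod.ext rfl ?_
  exact A.velocity_of_hor_eq hz1 z.2 A' hz2 _ rfl rfl

theorem contDiffOn_transition (A A' : AdaptedChart π) :
    ContDiffOn ℝ ∞ (transition A A') {z | z.1 ∈ (A.tot.symm.trans A'.tot).source} := by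
  have hT : ContDiffOn ℝ ∞ (A'.tot ∘ A.tot.symm) (A.tot.symm.trans A'.tot).source := by
    have h1 := contMDiffOn_of_mem_maximalAtlas A'.tot_mem
    have h2 := contMDiffOn_symm_of_mem_maximalAtlas A.tot_mem
    have h3 := h1.comp (h2.mono (t := (A.tot.symm.trans A'.tot).source)
      (fun x hx => hx.1))
      (fun x hx => hx.2)
    exact h3.contDiffOn
  have hB : ContDiffOn ℝ ∞ (A.base ∘ A'.base.symm) (A'.base.symm.trans A.base).source := by
    have h1 := contMDiffOn_of_mem_maximalAtlas A.base_mem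
    have h2 := contMDiffOn_symm_of_mem_maximalAtlas A'.base_mem
    have h3 := h1.comp (h2.mono (t := (A'.base.symm.trans A.base).source)
      (fun x hx => hx.1))
      (fun x hx => hx.2)
    exact h3.contDiffOn
  have hT' := hT.fderiv_of_isOpen (m := ∞) (A.tot.symm.trans A'.tot).open_source (by simp)
  have hB' := hB.fderiv_of_isOpen (m := ∞) (A'.base.symm.trans A.base).open_source (by simp)
  have hfst : ContDiffOn ℝ ∞ (Prod.fst : (B × F) × (B →L[ℝ] F) → B × F)
      {z | z.1 ∈ (A.tot.symm.trans A'.tot).source} := contDiff_fst.contDiffOn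
  have hTz := hT.comp hfst (fun z hz => hz)
  have hTz' := hT'.comp hfst (fun z hz => hz)
  have hBz' := hB'.comp (contDiff_fst.comp_contDiffOn hTz) (by
    intro z hz
    have hz1 : z.1 ∈ A.tot.target := by
      have := hz; simp at this; exact this.1
    have hz2 : A.tot.symm z.1 ∈ A'.tot.source := by
      have := hz; simp at this; exact this.2
    have hx := A.proj_mem _ (A.tot.map_target hz1)
    have hx' := A'.proj_mem _ hz2
    have h1 : (A'.tot (A.tot.symm z.1)).1 = _ := (A'.base_proj _ hz2).symm
    simp only [Set.mem_preimage, Function.comp_apply, OpenPartialHomeomorph.trans_source,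
      OpenPartialHomeomorph.symm_source, Set.mem_inter_iff, h1]
    exact ⟨A'.base.map_source hx', by rw [A'.base.left_inv hx']; exact hx⟩)
  have hp : ContDiffOn ℝ ∞ (fun z : (B × F) × (B →L[ℝ] F) =>
      (ContinuousLinearMap.id ℝ B).prod z.2)
      {z | z.1 ∈ (A.tot.symm.trans A'.tot).source} := by
    have : (fun z : (B × F) × (B →L[ℝ] F) => (ContinuousLinearMap.id ℝ B).prod z.2) =
        fun z => ContinuousLinearMap.inl ℝ B F ∘L ContinuousLinearMap.id ℝ B +
          ContinuousLinearMap.inr ℝ B F ∘L z.2 := by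
      funext z
      ext v <;> simp
    rw [this]
    exact (contDiff_const.add (contDiff_const.clm_comp contDiff_snd)).contDiffOn
  exact hTz.prodMk (contDiffOn_const.clm_comp (hTz'.clm_comp (hp.clm_comp hBz')))

end AdaptedChart

namespace FirstJet

variable (π : SmoothBundle B F M E)
  [IsManifold 𝓘(ℝ, B) ∞ M] [IsManifold 𝓘(ℝ, B × F) ∞ E]

/-- The atlas of `J¹π` consisting of the coordinates induced by adapted coordinates on `E`. -/
def chartedSpaceCore : ChartedSpaceCore ((B × F) × (B →L[ℝ] F)) (FirstJet π) where
  atlas := {e | ∃ (A : AdaptedChart π) (j₀ : FirstJet π), e = A.jetCoord j₀}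
  chartAt j := (π.exists_adaptedChart j.pt).choose.jetCoord j
  mem_chart_source j := (π.exists_adaptedChart j.pt).choose_spec
  chart_mem_atlas j := ⟨_, j, rfl⟩
  open_source := by
    rintro _ _ ⟨A, j₀, rfl⟩ ⟨A', j₀', rfl⟩
    rw [AdaptedChart.jetCoord_trans_source]
    exact (A.tot.symm.trans A'.tot).open_source.preimage continuous_fst
  continuousOn_toFun := by
    rintro _ _ ⟨A, j₀, rfl⟩ ⟨A', j₀', rfl⟩
    rw [AdaptedChart.jetCoord_trans_source]
    exact (AdaptedChart.contDiffOn_transition A A').continuousOn.congr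
      (AdaptedChart.jetCoord_trans_eqOn A A' j₀ j₀')

instance : TopologicalSpace (FirstJet π) := (chartedSpaceCore π).toTopologicalSpace

instance : ChartedSpace ((B × F) × (B →L[ℝ] F)) (FirstJet π) :=
  (chartedSpaceCore π).toChartedSpace

instance : IsManifold 𝓘(ℝ, (B × F) × (B →L[ℝ] F)) ∞ (FirstJet π) := by
  apply isManifold_of_contDiffOn
  intro e e' he he'
  obtain ⟨_, ⟨A, j₀, rfl⟩, he⟩ := Set.mem_iUnion₂.1 he
  obtain ⟨_, ⟨A', j₀', rfl⟩, he'⟩ := Set.mem_iUnion₂.1 he'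
  obtain rfl := Set.mem_singleton_iff.1 he
  obtain rfl := Set.mem_singleton_iff.1 he'
  have h := (AdaptedChart.contDiffOn_transition A A').congr
    (AdaptedChart.jetCoord_trans_eqOn A A' j₀ j₀')
  rw [← AdaptedChart.jetCoord_trans_source A A' j₀ j₀'] at h
  simp only [modelWithCornersSelf_coe, modelWithCornersSelf_coe_symm, Function.id_comp,
    Function.comp_id, Set.range_id, Set.inter_univ, Set.preimage_id]
  exact h

end FirstJet

end FirstJetBundle

section DifferentialForms

variable {H N : Type*} [NormedAddCommGroup H] [NormedSpace ℝ H]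
  [TopologicalSpace N] [ChartedSpace H N]

variable (H N) in
/-- (Not necessarily smooth) differential forms of degree `k` on a manifold `N` modelled on `H`. -/
abbrev DiffForm (k : ℕ) := (p : N) → TangentSpace 𝓘(ℝ, H) p [⋀^Fin k]→L[ℝ] ℝ

/-- The expression of a differential form in a chart. -/
def DiffForm.inChart {k : ℕ} (α : DiffForm H N k) (e : OpenPartialHomeomorph N H) (y : H) :
    H [⋀^Fin k]→L[ℝ] ℝ :=
  (α (e.symm y)).compContinuousLinearMap (mfderiv 𝓘(ℝ, H) 𝓘(ℝ, H) e.symm y)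

/-- Smoothness of a differential form, in charts. -/
def DiffForm.IsSmooth {k : ℕ} (α : DiffForm H N k) : Prop :=
  ∀ e ∈ atlas H N, ContDiffOn ℝ ∞ (α.inChart e) e.target

/-- The exterior derivative of a differential form on a manifold, computed in a chart. -/
def DiffForm.extDeriv {k : ℕ} (α : DiffForm H N k) : DiffForm H N (k + 1) := fun p =>
  (_root_.extDeriv (α.inChart (chartAt H p)) (chartAt H p p)).compContinuousLinearMap
    (mfderiv 𝓘(ℝ, H) 𝓘(ℝ, H) (chartAt H p) p)

/-- A volume form: a nowhere vanishing smooth form of degree `dim N`. -/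
def DiffForm.IsVolumeForm {k : ℕ} (α : DiffForm H N k) : Prop :=
  k = Module.finrank ℝ H ∧ α.IsSmooth ∧ ∀ p, α p ≠ 0

end DifferentialForms

section Distributions

variable {B H M N : Type*} [NormedAddCommGroup B] [NormedSpace ℝ B]
  [NormedAddCommGroup H] [NormedSpace ℝ H]
  [TopologicalSpace M] [ChartedSpace B M] [TopologicalSpace N] [ChartedSpace H N]

/-- A vector field is smooth on the set `U`. -/
def IsSmoothVectorFieldOn (X : (p : N) → TangentSpace 𝓘(ℝ, H) p) [IsManifold 𝓘(ℝ, H) ∞ N]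
    (U : Set N) : Prop :=
  ContMDiffOn 𝓘(ℝ, H) 𝓘(ℝ, H).tangent ∞ (fun p => (⟨p, X p⟩ : TangentBundle 𝓘(ℝ, H) N)) U

variable (H N) in
/-- A field of linear subspaces of the tangent spaces of `N`. -/
abbrev SubspaceField := (p : N) → Submodule ℝ (TangentSpace 𝓘(ℝ, H) p)

namespace SubspaceField

/-- `D` is a `k`-dimensional distribution on `N`, that is, a smooth rank `k` subbundle of `TN`:
it is locally spanned by `k` linearly independent smooth vector fields. -/
def IsDistribution [IsManifold 𝓘(ℝ, H) ∞ N] (k : ℕ) (D : SubspaceField H N) : Prop :=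
  ∀ p : N, ∃ U : Set N, IsOpen U ∧ p ∈ U ∧
    ∃ X : Fin k → (q : N) → TangentSpace 𝓘(ℝ, H) q,
      (∀ i, IsSmoothVectorFieldOn (X i) U) ∧
      ∀ q ∈ U, LinearIndependent ℝ (fun i => X i q) ∧
        Submodule.span ℝ (Set.range fun i => X i q) = D q

end SubspaceField

variable (B H) in
/-- `s` is a smooth local section, with domain the open set `U`, of `p : N → M`. -/
structure IsLocalSection (p : N → M) (U : Set M) (s : M → N) : Prop where
  isOpen : IsOpen U
  contMDiffOn : ContMDiffOn 𝓘(ℝ, B) 𝓘(ℝ, H) ∞ s U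
  proj_eq : ∀ x ∈ U, p (s x) = x

variable (B) in
/-- `s : U → N` is an integral section of `D`: a local section of `p` such that
`T_q (Im s) = D_q` at every `q ∈ Im s`. -/
def IsIntegralSection (p : N → M) (D : SubspaceField H N) (U : Set M) (s : M → N) : Prop :=
  IsLocalSection B H p U s ∧
    ∀ x ∈ U, (mfderiv 𝓘(ℝ, B) 𝓘(ℝ, H) s x).range = D (s x)

variable (B) in
/-- Integrability of a distribution transverse to the fibres of `p` (so that its integral manifolds
are local sections of `p`): there is an integral section through every point. -/
def IsIntegrableDistribution (p : N → M) (D : SubspaceField H N) : Prop :=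
  ∀ q : N, ∃ (U : Set M) (s : M → N), IsIntegralSection B p D U s ∧ ∃ x ∈ U, s x = q

end Distributions

section Orthogonality

variable {V : Type*} [AddCommGroup V] [Module ℝ V] [TopologicalSpace V]

/-- The `l`-th orthogonal complement of a subspace `W`, with respect to an `(l+1)`-form. -/
def orthogonalComplement {l : ℕ} (α : V [⋀^Fin (l + 1)]→L[ℝ] ℝ) (W : Submodule ℝ V) : Set V :=
  {u | ∀ v : Fin l → V, (∀ i, v i ∈ W) → α (Fin.cons u v) = 0}

/-- `W` is `l`-Lagrangian with respect to an `(l+1)`-form. -/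
def IsLagrangianSubspace {l : ℕ} (α : V [⋀^Fin (l + 1)]→L[ℝ] ℝ) (W : Submodule ℝ V) : Prop :=
  (W : Set V) = orthogonalComplement α W

end Orthogonality

section Insertion

variable {T B W : Type*} [NormedAddCommGroup T] [NormedSpace ℝ T]
  [NormedAddCommGroup B] [NormedSpace ℝ B] [FiniteDimensional ℝ B]
  [NormedAddCommGroup W] [NormedSpace ℝ W]

/-- The `m`-form `v ↦ ∑ₖ ℓ (X ↦ η (τ v₁, …, X, …, τ vₘ) θ(vₖ))`, with `X` in the `k`-th place. -/
def insertionForm {m : ℕ} (η : B [⋀^Fin m]→L[ℝ] ℝ) (τ : T →L[ℝ] B) (θ : T →L[ℝ] W)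
    (ℓ : (B →L[ℝ] W) →L[ℝ] ℝ) : T [⋀^Fin m]→L[ℝ] ℝ where
  toFun v := ∑ k, ℓ ((η.toContinuousLinearMap (τ ∘ v) k).smulRight (θ (v k)))
  map_update_add' := by
    intro dec v i x y
    obtain rfl : dec = instDecidableEqFin m := Subsingleton.elim _ _
    rw [← Finset.sum_add_distrib]
    refine Finset.sum_congr rfl fun k _ => ?_
    rw [← map_add]
    congr 1
    ext X
    by_cases hk : k = i
    · subst hk
      simp [Function.comp_update, ContinuousAlternatingMap.toContinuousLinearMap, smul_add]
    · have hc : ∀ z, Function.update (Function.update (τ ∘ v) i z) k X =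
          Function.update (Function.update (τ ∘ v) k X) i z :=
        fun z => Function.update_comm (fun h => hk h.symm) _ _ _
      have h1 : ∀ z, η.toContinuousLinearMap (Function.update (τ ∘ v) i z) k X =
          η (Function.update (Function.update (τ ∘ v) k X) i z) := fun z => congrArg η (hc z)
      simp only [Function.comp_update, ContinuousLinearMap.smulRight_apply, h1, map_add,
        Function.update_of_ne hk, add_apply, η.map_update_add, add_smul]
  map_update_smul' := by
    intro dec v i c x
    obtain rfl : dec = instDecidableEqFin m := Subsingleton.elim _ _
    rw [Finset.smul_sum]
    refine Finset.sum_congr rfl fun k _ => ?_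
    rw [← map_smul]
    congr 1
    ext X
    by_cases hk : k = i
    · subst hk
      simp [Function.comp_update, ContinuousAlternatingMap.toContinuousLinearMap, smul_comm c]
    · have hc : ∀ z, Function.update (Function.update (τ ∘ v) i z) k X =
          Function.update (Function.update (τ ∘ v) k X) i z :=
        fun z => Function.update_comm (fun h => hk h.symm) _ _ _
      have h1 : ∀ z, η.toContinuousLinearMap (Function.update (τ ∘ v) i z) k X =
          η (Function.update (Function.update (τ ∘ v) k X) i z) := fun z => congrArg η (hc z)
      simp only [Function.comp_update, ContinuousLinearMap.smulRight_apply, h1, map_smul,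
        Function.update_of_ne hk, smul_apply, η.map_update_smul, mul_smul, smul_eq_mul]
  map_eq_zero_of_eq' := by
    intro v i j hv hij
    have h0 : ∀ k, k ≠ i → k ≠ j →
        (η.toContinuousLinearMap (τ ∘ v) k).smulRight (θ (v k)) = 0 := by
      intro k hki hkj
      ext X
      have : η (Function.update (τ ∘ v) k X) = 0 := by
        refine η.map_eq_zero_of_eq _ (i := i) (j := j) ?_ hij
        rw [Function.update_of_ne hki.symm, Function.update_of_ne hkj.symm]
        simp [hv]
      simp [ContinuousAlternatingMap.toContinuousLinearMap, this]
    have h1 : (η.toContinuousLinearMap (τ ∘ v) j).smulRight (θ (v j)) =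
        -(η.toContinuousLinearMap (τ ∘ v) i).smulRight (θ (v i)) := by
      ext X
      have h2 : Function.update (τ ∘ v) j X = Function.update (τ ∘ v) i X ∘ Equiv.swap i j := by
        funext k
        by_cases hki : k = i
        · subst hki
          simp [hij, Function.update_of_ne hij.symm, hv]
        · by_cases hkj : k = j
          · subst hkj
            simp
          · simp [Equiv.swap_apply_of_ne_of_ne hki hkj, hki, hkj]
      have h3 : η (Function.update (τ ∘ v) j X) = -η (Function.update (τ ∘ v) i X) := by
        rw [h2]
        exact η.toAlternatingMap.map_swap _ hij
      simp [ContinuousAlternatingMap.toContinuousLinearMap, h3, hv]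
    change ∑ k, ℓ ((η.toContinuousLinearMap (τ ∘ v) k).smulRight (θ (v k))) = 0
    rw [Finset.sum_eq_add i j hij (fun k _ hk => by rw [h0 k hk.1 hk.2, map_zero]) (by simp)
      (by simp), h1, map_neg, add_neg_cancel]
  cont := by
    refine continuous_finsetSum _ fun k _ => ℓ.continuous.comp ?_
    rw [continuous_clm_apply]
    intro X
    have h : Continuous fun v : Fin m → T => η (Function.update (τ ∘ v) k X) :=
      η.cont.comp ((continuous_pi fun i => τ.continuous.comp (continuous_apply i)).update k
        continuous_const)
    exact h.smul (θ.continuous.comp (continuous_apply k))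

end Insertion

section LagrangianFieldTheory

variable {B F M E : Type*}
  [NormedAddCommGroup B] [NormedSpace ℝ B] [FiniteDimensional ℝ B]
  [NormedAddCommGroup F] [NormedSpace ℝ F]
  [TopologicalSpace M] [ChartedSpace B M] [IsManifold 𝓘(ℝ, B) ∞ M]
  [TopologicalSpace E] [ChartedSpace (B × F) E] [IsManifold 𝓘(ℝ, B × F) ∞ E]

variable (B F) in
/-- The model space of `J¹π`, with coordinates `(x, u, uᵢ)`. -/
abbrev JetModel := (B × F) × (B →L[ℝ] F)

/-- The tangent map `T_uπ`. -/
def SmoothBundle.dProj (π : SmoothBundle B F M E) (u : E) : B × F →L[ℝ] B :=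
  mfderiv 𝓘(ℝ, B × F) 𝓘(ℝ, B) π.proj u

/-- The vertical space `V_uπ = ker T_uπ`. -/
def SmoothBundle.vertical (π : SmoothBundle B F M E) (u : E) : Submodule ℝ (B × F) :=
  (π.dProj u).ker

namespace FirstJet

variable {π : SmoothBundle B F M E}

/-- The projection `J¹π → M`. -/
def projBase (j : FirstJet π) : M := π.proj j.pt

/-- The tangent map of `J¹π → E` at `j`. -/
def dPt (j : FirstJet π) : JetModel B F →L[ℝ] B × F :=
  mfderiv 𝓘(ℝ, JetModel B F) 𝓘(ℝ, B × F) (FirstJet.pt (π := π)) j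

/-- The tangent map of `J¹π → M` at `j`. -/
def dProjBase (j : FirstJet π) : JetModel B F →L[ℝ] B :=
  mfderiv 𝓘(ℝ, JetModel B F) 𝓘(ℝ, B) (FirstJet.projBase (π := π)) j

/-- The linear map `T_{π u}M → T_uE` given by a jet `j` over `u`. -/
def horMap (j : FirstJet π) : B →L[ℝ] B × F := j.hor

theorem dProj_horMap (j : FirstJet π) (v : B) : π.dProj j.pt (j.horMap v) = v := j.mfderiv_hor v

/-- The affine structure of the fibre `J¹_uπ`, modelled on `Hom(T_{π u}M, V_uπ)`. -/
def translate (j : FirstJet π) (φ : B →L[ℝ] π.vertical j.pt) : FirstJet π where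
  pt := j.pt
  hor := (j.horMap + (π.vertical j.pt).subtypeL ∘L φ : B →L[ℝ] B × F)
  mfderiv_hor v := by
    have h2 : π.dProj j.pt (φ v : B × F) = 0 := (φ v).2
    have h3 : ∀ w : B, π.dProj j.pt (φ w : B × F) = 0 →
        π.dProj j.pt (j.horMap w + (φ w : B × F)) = w := by
      intro w hw
      rw [map_add, j.dProj_horMap, hw, add_zero]
    exact h3 v h2

/-- The canonical structure form `θ_j(v) = (Id - T(φ ∘ π))(Tπ¹ v)`, where `j = j¹ₓφ`. -/
def structureForm (j : FirstJet π) : JetModel B F →L[ℝ] π.vertical j.pt :=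
  (j.dPt - j.horMap ∘L π.dProj j.pt ∘L j.dPt).codRestrict (π.vertical j.pt) fun v => by
    have h2 : π.dProj j.pt (j.dPt v - j.horMap (π.dProj j.pt (j.dPt v))) = 0 := by
      rw [map_sub, j.dProj_horMap, sub_self]
    exact h2

/-- The 1-jet `j¹ₓφ` of a local section `φ` of `π` at a point `x` of its domain. -/
def prolongation {φ : M → E} {U : Set M} (hφ : IsLocalSection B (B × F) π.proj U φ)
    {x : M} (hx : x ∈ U) : FirstJet π where
  pt := φ x
  hor := (mfderiv 𝓘(ℝ, B) 𝓘(ℝ, B × F) φ x : B →L[ℝ] B × F)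
  mfderiv_hor v := by
    have hφx : MDifferentiableAt 𝓘(ℝ, B) 𝓘(ℝ, B × F) φ x :=
      (hφ.contMDiffOn.contMDiffAt (hφ.isOpen.mem_nhds hx)).mdifferentiableAt (by simp)
    have h := mfderiv_comp x (π.mdifferentiableAt (φ x)) hφx
    have h' : (π.proj ∘ φ) =ᶠ[𝓝 x] id := by
      filter_upwards [hφ.isOpen.mem_nhds hx] with y hy using hφ.proj_eq y hy
    rw [h'.mfderiv_eq, mfderiv_id] at h
    exact (DFunLike.congr_fun h v).symm

end FirstJet

variable {π : SmoothBundle B F M E}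

/-- The vertical derivative of the Lagrangian function `L` at `j ∈ J¹_uπ`: the derivative at `j` of
the restriction of `L` to the affine space `J¹_uπ`. -/
def verticalDeriv (L : FirstJet π → ℝ) (j : FirstJet π) :
    (B →L[ℝ] π.vertical j.pt) →L[ℝ] ℝ :=
  fderiv ℝ (fun φ => L (j.translate φ)) 0

/-- The Hessian at `j` of the restriction of `L` to the affine space `J¹_uπ`; its matrix is
`(∂²L / ∂uᵢ^α ∂uⱼ^β)`. -/
def verticalHessian (L : FirstJet π → ℝ) (j : FirstJet π) :
    (B →L[ℝ] π.vertical j.pt) →L[ℝ] (B →L[ℝ] π.vertical j.pt) →L[ℝ] ℝ :=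
  fderiv ℝ (fderiv ℝ (fun φ => L (j.translate φ))) 0

/-- Regularity of the Lagrangian: its Hessian in the derivative variables is nondegenerate. -/
def IsRegularLagrangian (L : FirstJet π → ℝ) : Prop :=
  ∀ (j : FirstJet π) (φ : B →L[ℝ] π.vertical j.pt),
    (∀ χ, verticalHessian L j φ χ = 0) → φ = 0

/-- The Lagrangian density `𝓛 = L (π̄¹)^*η`, a semibasic `m`-form on `J¹π`. -/
def lagrangianDensity {m : ℕ} (η : DiffForm B M m) (L : FirstJet π → ℝ) (j : FirstJet π) :
    JetModel B F [⋀^Fin m]→L[ℝ] ℝ :=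
  L j • (η j.projBase).compContinuousLinearMap j.dProjBase

/-- The Cartan `m`-form `Θ_𝓛 = i(ν)d𝓛 + 𝓛`, where `ν` is the canonical vertical endomorphism. The
first term is `v ↦ ∑ₖ d^vL (X ↦ η(Tπ̄¹ v₁, …, X, …, Tπ̄¹ vₘ) θ(vₖ))`, in coordinates
`∂L/∂uᵢ^α (du^α - uⱼ^α dx^j) ∧ i(∂/∂x^i)η`. -/
def cartanForm {m : ℕ} (η : DiffForm B M m) (L : FirstJet π → ℝ) :
    DiffForm (JetModel B F) (FirstJet π) m := fun j =>
  insertionForm (T := JetModel B F) (B := B) (η j.projBase) j.dProjBase j.structureForm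
    (verticalDeriv L j) + lagrangianDensity η L j

/-- The Cartan `(m+1)`-form `Ω_𝓛 = -dΘ_𝓛`. -/
def multisymplecticCartanForm {m : ℕ} (η : DiffForm B M m) (L : FirstJet π → ℝ) :
    DiffForm (JetModel B F) (FirstJet π) (m + 1) := fun j =>
  -(cartanForm η L).extDeriv j

/-- `D` is a solution `D_𝓛` of the Lagrangian problem: an `m`-dimensional, integrable distribution
in `J¹π`, transverse to `J¹π → M`, whose integral sections are prolongations `j¹φ` of sections `φ`
of `π` that satisfy `(j¹φ)^* i(X) Ω_𝓛 = 0` for every vector field `X` on `J¹π`. -/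
structure IsLagrangianDistribution {m : ℕ} (η : DiffForm B M m) (L : FirstJet π → ℝ)
    (D : SubspaceField (JetModel B F) (FirstJet π)) : Prop where
  isDistribution : D.IsDistribution m
  transverse : ∀ j : FirstJet π, Disjoint (D j) j.dProjBase.ker
  integrable : IsIntegrableDistribution B FirstJet.projBase D
  isProlongation : ∀ (U : Set M) (ψ : M → FirstJet π),
    IsIntegralSection B FirstJet.projBase D U ψ →
      ∃ (φ : M → E) (hφ : IsLocalSection B (B × F) π.proj U φ),
        ∀ x (hx : x ∈ U), ψ x = FirstJet.prolongation hφ hx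
  fieldEquation : ∀ (U : Set M) (ψ : M → FirstJet π),
    IsIntegralSection B FirstJet.projBase D U ψ →
      ∀ X : (j : FirstJet π) → TangentSpace 𝓘(ℝ, JetModel B F) j,
        IsSmoothVectorFieldOn X Set.univ → ∀ x ∈ U, ∀ v : Fin m → TangentSpace 𝓘(ℝ, B) x,
          multisymplecticCartanForm η L (ψ x) (Fin.cons (X (ψ x))
            fun i => mfderiv 𝓘(ℝ, B) 𝓘(ℝ, JetModel B F) ψ x (v i)) = 0

/-- A jet field: a smooth global section of `J¹π → E`. -/
structure JetField (π : SmoothBundle B F M E) where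
  toFun : E → FirstJet π
  contMDiff : ContMDiff 𝓘(ℝ, B × F) 𝓘(ℝ, JetModel B F) ∞ toFun
  pt_toFun : ∀ u, (toFun u).pt = u

namespace JetField

variable (Ψ : JetField π)

/-- The distribution `D(Ψ)` in `E` associated with the jet field: the horizontal subspaces. -/
def distribution : SubspaceField (B × F) E := fun u =>
  (Ψ.toFun u).horMap.range

/-- `Ψ` is integrable if `D(Ψ)` is. -/
def IsIntegrable : Prop := IsIntegrableDistribution B π.proj Ψ.distribution

/-- The tangent map of `Ψ` at `u`; its range is the tangent space of `Im Ψ` at `Ψ(u)`. -/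
def tangentMap (u : E) : B × F →L[ℝ] JetModel B F :=
  mfderiv 𝓘(ℝ, B × F) 𝓘(ℝ, JetModel B F) Ψ.toFun u

/-- The pullback `Ψ^*α`. -/
def pullback {k : ℕ} (α : DiffForm (JetModel B F) (FirstJet π) k) : DiffForm (B × F) E k :=
  fun u => (α (Ψ.toFun u)).compContinuousLinearMap (Ψ.tangentMap u)

/-- The distribution `Tπ¹(D|_{Im Ψ})` in `E`. -/
def associated (D : SubspaceField (JetModel B F) (FirstJet π)) : SubspaceField (B × F) E :=
  fun u => (D (Ψ.toFun u)).map ((Ψ.toFun u).dPt : JetModel B F →ₗ[ℝ] B × F)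

/-- `Ψ` is a solution of the generalized Lagrangian Hamilton-Jacobi problem: it is integrable, and
`Ψ ∘ γ` is an integral section of `D` whenever `γ` is an integral section of the `m`-dimensional
and integrable distribution `Tπ¹(D|_{Im Ψ})`. -/
structure IsGeneralizedSolution (m : ℕ) (D : SubspaceField (JetModel B F) (FirstJet π)) :
    Prop where
  integrable : Ψ.IsIntegrable
  associated_isDistribution : (Ψ.associated D).IsDistribution m
  associated_integrable : IsIntegrableDistribution B π.proj (Ψ.associated D)
  comp_isIntegralSection : ∀ (U : Set M) (γ : M → E),
    IsIntegralSection B π.proj (Ψ.associated D) U γ →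
      IsIntegralSection B FirstJet.projBase D U (Ψ.toFun ∘ γ)

/-- `Ψ` is a solution of the Lagrangian Hamilton-Jacobi problem: a solution of the generalized
problem with `Ψ^*Ω_𝓛 = 0`. -/
def IsSolution {m : ℕ} (η : DiffForm B M m) (L : FirstJet π → ℝ)
    (D : SubspaceField (JetModel B F) (FirstJet π)) : Prop :=
  Ψ.IsGeneralizedSolution m D ∧ Ψ.pullback (multisymplecticCartanForm η L) = 0

/-- The submanifold `Im Ψ` is `l`-Lagrangian with respect to an `(l+1)`-form. -/
def IsLagrangianImage {l : ℕ} (α : DiffForm (JetModel B F) (FirstJet π) (l + 1)) : Prop :=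
  ∀ u : E, IsLagrangianSubspace (α (Ψ.toFun u)) (Ψ.tangentMap u).range

/-- The distribution `D` is tangent to the submanifold `Im Ψ`. -/
def IsTangentToImage (D : SubspaceField (JetModel B F) (FirstJet π)) : Prop :=
  ∀ u : E, D (Ψ.toFun u) ≤ (Ψ.tangentMap u).range

/-- `ψ` is an integral section of `D`, with a connected domain `U`, that satisfies a boundary
condition in `Im Ψ`, that is, passes through some point of `Im Ψ`. -/
def IsIntegralSectionMeetingImage (D : SubspaceField (JetModel B F) (FirstJet π)) (U : Set M)
    (ψ : M → FirstJet π) : Prop :=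
  IsConnected U ∧ IsIntegralSection B FirstJet.projBase D U ψ ∧
    ∃ x ∈ U, ψ x ∈ Set.range Ψ.toFun

/-- The integral sections of `D` with boundary conditions in `Im Ψ` project onto the integral
sections of `Tπ¹(D|_{Im Ψ})` (on connected domains): each of the former projects to one of the
latter, and each of the latter is obtained in this way. -/
def ProjectsOntoIntegralSections (D : SubspaceField (JetModel B F) (FirstJet π)) : Prop :=
  (∀ (U : Set M) (ψ : M → FirstJet π), Ψ.IsIntegralSectionMeetingImage D U ψ →
    IsIntegralSection B π.proj (Ψ.associated D) U (fun x => (ψ x).pt)) ∧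
  ∀ (U : Set M) (γ : M → E), IsConnected U →
    IsIntegralSection B π.proj (Ψ.associated D) U γ →
      ∃ ψ : M → FirstJet π, Ψ.IsIntegralSectionMeetingImage D U ψ ∧ ∀ x ∈ U, (ψ x).pt = γ x

end JetField

end LagrangianFieldTheory

end

/-!
Since the integral sections of `D` are prolongations, `Tπ¹` maps `D j` onto the horizontal space of
the jet `j`. Hence `Tπ¹(D|Im Ψ)` is the distribution of `Ψ` itself, which is integrable, and the
Hamilton–Jacobi problem asks no more than that `D` be tangent to `Im Ψ`.

The condition that `Im Ψ` be `m`-Lagrangian is automatic. It is isotropic because `Ψ^* Ω = 0`. If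
`w` is in the `Ω`-orthogonal of its tangent space, so is the `π¹`-vertical vector `w - TΨ(Tπ¹ w)`;
but contracting `Ω` with a vertical vector and with vectors tangent to `Im Ψ` gives the vertical
Hessian of `L`, which is nondegenerate, so that vertical vector vanishes.

Finally, an integral section of `D` solves a total differential equation, so it is determined near a
point by its value there. One that meets `Im Ψ` therefore agrees locally with some `Ψ ∘ γ`, and,
`Im Ψ` being closed, it stays in `Im Ψ` as long as its domain is connected.
-/

noncomputable section

section TotalDifferentialEquations

variable {B H V : Type*} [NormedAddCommGroup B] [NormedSpace ℝ B]
  [NormedAddCommGroup H] [NormedSpace ℝ H] [NormedAddCommGroup V] [NormedSpace ℝ V]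

theorem hasDerivAt_comp_lineMap {f : B → H} {x₀ x : B} {t : ℝ} {T : B →L[ℝ] H}
    (hf : HasFDerivAt f T (AffineMap.lineMap x₀ x t)) :
    HasDerivAt (fun t : ℝ => f (AffineMap.lineMap x₀ x t)) (T (x - x₀)) t :=
  hf.comp_hasDerivAt t AffineMap.hasDerivAt_lineMap

theorem eventuallyEq_of_hasFDerivAt {Φ : H → B →L[ℝ] H} {f g : B → H} {x₀ : B}
    (hΦ : ContDiffAt ℝ 1 Φ (f x₀)) (hf : ∀ᶠ x in 𝓝 x₀, HasFDerivAt f (Φ (f x)) x)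
    (hg : ∀ᶠ x in 𝓝 x₀, HasFDerivAt g (Φ (g x)) x) (hfg : f x₀ = g x₀) : f =ᶠ[𝓝 x₀] g := by
  obtain ⟨K, S, hS, hK⟩ := hΦ.exists_lipschitzOnWith
  have hfS : ∀ᶠ x in 𝓝 x₀, f x ∈ S := hf.self_of_nhds.continuousAt hS
  have hgS : ∀ᶠ x in 𝓝 x₀, g x ∈ S := hg.self_of_nhds.continuousAt (hfg ▸ hS)
  obtain ⟨r, hr, hball⟩ :=
    Metric.eventually_nhds_iff_ball.1 (hf.and (hg.and (hfS.and hgS)))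
  filter_upwards [Metric.ball_mem_nhds x₀ hr] with x hx
  have hsegment : ∀ t ∈ Set.Icc (0 : ℝ) 1, AffineMap.lineMap x₀ x t ∈ Metric.ball x₀ r :=
    fun t ht => (convex_ball x₀ r).lineMap_mem (Metric.mem_ball_self hr) hx ht
  have hderivf : ∀ t ∈ Set.Icc (0 : ℝ) 1, HasDerivAt _ _ t :=
    fun t ht => hasDerivAt_comp_lineMap (hball _ (hsegment t ht)).1
  have hderivg : ∀ t ∈ Set.Icc (0 : ℝ) 1, HasDerivAt _ _ t :=
    fun t ht => hasDerivAt_comp_lineMap (hball _ (hsegment t ht)).2.1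
  have hlipschitz : ∀ t ∈ Set.Ico (0 : ℝ) 1,
      LipschitzOnWith (‖x - x₀‖₊ * K) (fun z => Φ z (x - x₀)) S :=
    fun _ _ => (ContinuousLinearMap.lipschitz_apply (x - x₀)).comp_lipschitzOnWith hK
  have hunique := ODE_solution_unique_of_mem_Icc_right hlipschitz
    (fun t ht => (hderivf t ht).continuousAt.continuousWithinAt)
    (fun t ht => (hderivf t (Set.Ico_subset_Icc_self ht)).hasDerivWithinAt)
    (fun t ht => (hball _ (hsegment t (Set.Ico_subset_Icc_self ht))).2.2.1)
    (fun t ht => (hderivg t ht).continuousAt.continuousWithinAt)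
    (fun t ht => (hderivg t (Set.Ico_subset_Icc_self ht)).hasDerivWithinAt)
    (fun t ht => (hball _ (hsegment t (Set.Ico_subset_Icc_self ht))).2.2.2)
    (by simpa using hfg)
  simpa using hunique (Set.right_mem_Icc.2 zero_le_one)

theorem isInvertible_comp_of_range_eq [FiniteDimensional ℝ V] {Q : H →L[ℝ] B} {A : V →L[ℝ] H}
    {T : B →L[ℝ] H} (hQT : Q ∘L T = .id ℝ B) (hTA : T.range = A.range)
    (hA : Function.Injective A) : (Q ∘L A).IsInvertible := by
  have hinv : ∀ b, Q (T b) = b := DFunLike.congr_fun hQT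
  have hbij : Function.Bijective (Q ∘L A) := by
    refine ⟨(injective_iff_map_eq_zero _).2 fun v hv => ?_, fun b => ?_⟩
    · obtain ⟨b, hb⟩ : A v ∈ T.range := hTA ▸ ⟨v, rfl⟩
      have hb : T b = A v := hb
      have : Q (A v) = 0 := hv
      exact hA (by rw [map_zero, ← hb, ← hinv b, hb, this, map_zero])
    · obtain ⟨v, hv⟩ : T b ∈ A.range := hTA ▸ ⟨b, rfl⟩
      exact ⟨v, (congrArg Q hv).trans (hinv b)⟩
  exact ⟨(LinearEquiv.ofBijective (Q ∘L A : V →ₗ[ℝ] B) hbij).toContinuousLinearEquiv, rfl⟩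

theorem eq_comp_inverse_of_range_le {Q : H →L[ℝ] B} {A : V →L[ℝ] H} {T : B →L[ℝ] H}
    (hQT : Q ∘L T = .id ℝ B) (hTA : T.range ≤ A.range) (hQA : (Q ∘L A).IsInvertible) :
    T = A ∘L (Q ∘L A).inverse := by
  ext b
  obtain ⟨v, hv⟩ : T b ∈ A.range := hTA ⟨b, rfl⟩
  have hQv : (Q ∘L A) v = b := (congrArg Q hv).trans (DFunLike.congr_fun hQT b)
  rw [← hv, ContinuousLinearMap.comp_apply, ← hQv, hQA.inverse_apply_self]
  rfl

theorem fderiv_comp_fderiv_eq_id {P : H → B} {f : B → H} {x : B}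
    (hP : DifferentiableAt ℝ P (f x)) (hf : DifferentiableAt ℝ f x)
    (hPf : ∀ᶠ y in 𝓝 x, P (f y) = y) : fderiv ℝ P (f x) ∘L fderiv ℝ f x = .id ℝ B := by
  have hid : P ∘ f =ᶠ[𝓝 x] id := hPf
  rw [← fderiv_comp x hP hf, hid.fderiv_eq, fderiv_id]

/-- `f` is near `x₀` a section of `P` whose tangent spaces are the ranges of `A`, the coordinate
form of an integral section; `A z` stands for a frame of the distribution at `z`. -/
def IsIntegralSectionNear (A : H → V →L[ℝ] H) (P : H → B) (f : B → H) (x₀ : B) : Prop :=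
  ∀ᶠ x in 𝓝 x₀, DifferentiableAt ℝ f x ∧ P (f x) = x ∧ (fderiv ℝ f x).range = (A (f x)).range

namespace IsIntegralSectionNear

variable [FiniteDimensional ℝ V] {A : H → V →L[ℝ] H} {P : H → B} {f g : B → H} {x₀ : B}

theorem isInvertible_comp (hf : IsIntegralSectionNear A P f x₀)
    (hP : DifferentiableAt ℝ P (f x₀)) (hinj : Function.Injective (A (f x₀))) :
    (fderiv ℝ P (f x₀) ∘L A (f x₀)).IsInvertible :=
  isInvertible_comp_of_range_eq
    (fderiv_comp_fderiv_eq_id hP hf.self_of_nhds.1 (hf.mono fun _ hx => hx.2.1))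
    hf.self_of_nhds.2.2 hinj

theorem eventually_hasFDerivAt (hf : IsIntegralSectionNear A P f x₀)
    (hA : ContinuousAt A (f x₀)) (hP : ContDiffAt ℝ 2 P (f x₀))
    (hinv : (fderiv ℝ P (f x₀) ∘L A (f x₀)).IsInvertible) :
    ∀ᶠ x in 𝓝 x₀, HasFDerivAt f (A (f x) ∘L (fderiv ℝ P (f x) ∘L A (f x)).inverse) x := by
  have hfc : ContinuousAt f x₀ := hf.self_of_nhds.1.continuousAt
  have hPdiff : ∀ᶠ z in 𝓝 (f x₀), DifferentiableAt ℝ P z :=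
    (hP.eventually (by simp)).mono fun z hz => hz.differentiableAt (by simp)
  have hinv' : ∀ᶠ z in 𝓝 (f x₀), (fderiv ℝ P z ∘L A z).IsInvertible := by
    have hdP : ContDiffAt ℝ 1 (fderiv ℝ P) (f x₀) := hP.fderiv_right (by norm_num)
    have hopen : ∀ᶠ T in 𝓝 (fderiv ℝ P (f x₀) ∘L A (f x₀)), T.IsInvertible := by
      obtain ⟨e, he⟩ := hinv
      rw [← he]
      exact e.nhds
    exact (hdP.continuousAt.clm_comp hA).eventually hopen
  filter_upwards [hf.eventually_nhds, hfc.eventually hPdiff, hfc.eventually hinv']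
    with x hx hPx hinvx
  obtain ⟨hfx, -, hrange⟩ := hx.self_of_nhds
  rw [← eq_comp_inverse_of_range_le
    (fderiv_comp_fderiv_eq_id hPx hfx (hx.mono fun _ hy => hy.2.1)) hrange.le hinvx]
  exact hfx.hasFDerivAt

theorem eventuallyEq (hf : IsIntegralSectionNear A P f x₀) (hg : IsIntegralSectionNear A P g x₀)
    (hfg : f x₀ = g x₀) (hA : ContDiffAt ℝ 1 A (f x₀)) (hP : ContDiffAt ℝ 2 P (f x₀))
    (hinj : Function.Injective (A (f x₀))) : f =ᶠ[𝓝 x₀] g := by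
  have : CompleteSpace V := FiniteDimensional.complete ℝ V
  have hinv := hf.isInvertible_comp (hP.differentiableAt (by simp)) hinj
  have hdP : ContDiffAt ℝ 1 (fderiv ℝ P) (f x₀) := hP.fderiv_right (by norm_num)
  have hlift : ContDiffAt ℝ 1 (fun z => A z ∘L (fderiv ℝ P z ∘L A z).inverse) (f x₀) :=
    hA.clm_comp
      (ContDiffAt.comp (g := ContinuousLinearMap.inverse) (f x₀) hinv.contDiffAt_map_inverse
        (hdP.clm_comp hA))
  refine eventuallyEq_of_hasFDerivAt hlift (hf.eventually_hasFDerivAt hA.continuousAt hP hinv)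
    (hg.eventually_hasFDerivAt ?_ ?_ ?_) hfg
  all_goals rw [← hfg]
  exacts [hA.continuousAt, hP, hinv]

end IsIntegralSectionNear

end TotalDifferentialEquations

section Frames

variable {H N : Type*} [NormedAddCommGroup H] [NormedSpace ℝ H]
  [TopologicalSpace N] [ChartedSpace H N] [IsManifold 𝓘(ℝ, H) ∞ N]

theorem trivializationAt_apply_snd_eq_mfderiv_chart {p q : N} (hq : q ∈ (chartAt H p).source)
    (v : TangentSpace 𝓘(ℝ, H) q) :
    (trivializationAt H (TangentSpace 𝓘(ℝ, H)) p ⟨q, v⟩).2 =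
      mfderiv 𝓘(ℝ, H) 𝓘(ℝ, H) (chartAt H p) q v := by
  have htriv := DFunLike.congr_fun
    (TangentBundle.continuousLinearMapAt_trivializationAt (I := 𝓘(ℝ, H)) hq) v
  rwa [Bundle.Trivialization.continuousLinearMapAt_apply,
    Bundle.Trivialization.coe_linearMapAt_of_mem _ (by simpa using hq)] at htriv

theorem IsSmoothVectorFieldOn.contDiffAt_chart {X : (p : N) → TangentSpace 𝓘(ℝ, H) p} {U : Set N}
    (hX : IsSmoothVectorFieldOn X U) (hU : IsOpen U) {p : N} (hp : p ∈ U) :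
    ContDiffAt ℝ ∞ (fun z : H => (mfderiv 𝓘(ℝ, H) 𝓘(ℝ, H) (chartAt H p)
      ((chartAt H p).symm z) (X ((chartAt H p).symm z)) : H)) (chartAt H p p) := by
  have hcoord : ContMDiffAt 𝓘(ℝ, H) 𝓘(ℝ, H) ∞
      (fun q => (mfderiv 𝓘(ℝ, H) 𝓘(ℝ, H) (chartAt H p) q (X q) : H)) p := by
    refine ((Bundle.contMDiffWithinAt_totalSpace.1 (hX p hp)).2.contMDiffAt
      (hU.mem_nhds hp)).congr_of_eventuallyEq ?_
    filter_upwards [chart_source_mem_nhds H p] with q hq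
    exact (trivializationAt_apply_snd_eq_mfderiv_chart hq (X q)).symm
  have hsymm : ContMDiffAt 𝓘(ℝ, H) 𝓘(ℝ, H) ∞ (chartAt H p).symm (chartAt H p p) :=
    contMDiffAt_symm_of_mem_maximalAtlas (IsManifold.chart_mem_maximalAtlas p)
      (mem_chart_target H p)
  exact (hcoord.comp_of_eq hsymm ((chartAt H p).left_inv (mem_chart_source H p))).contDiffAt

end Frames

section IntegralSections

variable {B H M N : Type*} [NormedAddCommGroup B] [NormedSpace ℝ B]
  [NormedAddCommGroup H] [NormedSpace ℝ H]
  [TopologicalSpace M] [ChartedSpace B M] [TopologicalSpace N] [ChartedSpace H N]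
  {p : N → M} {D : SubspaceField H N} {U : Set M} {s : M → N} {x : M}

namespace IsLocalSection

theorem mono (hs : IsLocalSection B H p U s) {W : Set M} (hW : IsOpen W) (hWU : W ⊆ U) :
    IsLocalSection B H p W s :=
  ⟨hW, hs.contMDiffOn.mono hWU, fun x hx => hs.proj_eq x (hWU hx)⟩

theorem mdifferentiableAt (hs : IsLocalSection B H p U s) (hx : x ∈ U) :
    MDifferentiableAt 𝓘(ℝ, B) 𝓘(ℝ, H) s x :=
  (hs.contMDiffOn.contMDiffAt (hs.isOpen.mem_nhds hx)).mdifferentiableAt (by simp)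

theorem mfderiv_proj_mfderiv (hs : IsLocalSection B H p U s) (hx : x ∈ U)
    (hp : MDifferentiableAt 𝓘(ℝ, H) 𝓘(ℝ, B) p (s x)) (v : B) :
    (mfderiv 𝓘(ℝ, H) 𝓘(ℝ, B) p (s x) : H →L[ℝ] B)
      ((mfderiv 𝓘(ℝ, B) 𝓘(ℝ, H) s x : B →L[ℝ] H) v) = v := by
  have hid : p ∘ s =ᶠ[𝓝 x] id := Filter.mem_of_superset (hs.isOpen.mem_nhds hx) hs.proj_eq
  have hcomp := mfderiv_comp x hp (hs.mdifferentiableAt hx)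
  rw [hid.mfderiv_eq, mfderiv_id] at hcomp
  exact (DFunLike.congr_fun hcomp v).symm

theorem contDiffAt_proj_chart (hs : IsLocalSection B H p U s) (hx : x ∈ U)
    (hp : ContMDiffAt 𝓘(ℝ, H) 𝓘(ℝ, B) ∞ p (s x)) :
    ContDiffAt ℝ ∞ (chartAt B x ∘ p ∘ (chartAt H (s x)).symm) (chartAt H (s x) (s x)) := by
  have hchart := (contMDiffAt_iff.1 hp).2
  rw [hs.proj_eq x hx] at hchart
  simpa only [extChartAt, mfld_simps, contDiffWithinAt_univ] using hchart

end IsLocalSection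

theorem SubspaceField.IsDistribution.exists_frame_chart [IsManifold 𝓘(ℝ, H) ∞ N] {k : ℕ}
    (hD : D.IsDistribution k) (q₀ : N) :
    ∃ A : H → (Fin k → ℝ) →L[ℝ] H, ContDiffAt ℝ ∞ A (chartAt H q₀ q₀) ∧
      Function.Injective (A (chartAt H q₀ q₀)) ∧ ∀ᶠ q in 𝓝 q₀, (A (chartAt H q₀ q)).range =
        (D q).map (mfderiv 𝓘(ℝ, H) 𝓘(ℝ, H) (chartAt H q₀) q).toLinearMap := by
  obtain ⟨W, hW, hq₀, X, hX, hframe⟩ := hD q₀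
  let Y (z : H) (i : Fin k) : H := mfderiv 𝓘(ℝ, H) 𝓘(ℝ, H) (chartAt H q₀)
    ((chartAt H q₀).symm z) (X i ((chartAt H q₀).symm z))
  have hY : ∀ q ∈ (chartAt H q₀).source, Y (chartAt H q₀ q) =
      fun i => (mfderiv 𝓘(ℝ, H) 𝓘(ℝ, H) (chartAt H q₀) q (X i q) : H) := by
    intro q hq
    simp only [Y]
    rw [(chartAt H q₀).left_inv hq]
  let A (z : H) : (Fin k → ℝ) →L[ℝ] H :=
    (ContinuousLinearEquiv.piRing (𝕜 := ℝ) (E := H) (Fin k)).symm (Y z)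
  have hA : ∀ z, (A z).toLinearMap = Fintype.linearCombination ℝ (Y z) := fun z =>
    LinearMap.ext fun c => LinearEquiv.piRing_symm_apply ℝ (Y z) c
  refine ⟨A, ?_, ?_, ?_⟩
  · exact (ContinuousLinearEquiv.piRing (𝕜 := ℝ) (E := H) (Fin k)).symm.contDiff.contDiffAt.comp _
      (contDiffAt_pi.2 fun i => (hX i).contDiffAt_chart hW hq₀)
  · have hindep : LinearIndependent ℝ (Y (chartAt H q₀ q₀)) := by
      rw [hY q₀ (mem_chart_source H q₀)]
      exact (hframe q₀ hq₀).1.map' _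
        ((mdifferentiable_chart q₀).ker_mfderiv_eq_bot (mem_chart_source H q₀))
    have hinj := linearIndependent_iff_injective_fintypeLinearCombination.1 hindep
    rwa [← hA] at hinj
  · filter_upwards [hW.mem_nhds hq₀, chart_source_mem_nhds H q₀] with q hqW hq
    rw [← (hframe q hqW).2, Submodule.map_span, ← Set.range_comp, hA,
      Fintype.range_linearCombination, hY q hq]
    rfl

namespace IsIntegralSection

theorem mono (hs : IsIntegralSection B p D U s) {W : Set M} (hW : IsOpen W) (hWU : W ⊆ U) :
    IsIntegralSection B p D W s :=
  ⟨hs.1.mono hW hWU, fun x hx => hs.2 x (hWU hx)⟩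

theorem congr {s' : M → N} (hs : IsIntegralSection B p D U s) (h : Set.EqOn s' s U) :
    IsIntegralSection B p D U s' := by
  refine ⟨⟨hs.1.isOpen, hs.1.contMDiffOn.congr h, fun x hx => by rw [h hx, hs.1.proj_eq x hx]⟩,
    fun x hx => ?_⟩
  rw [(h.eventuallyEq_of_mem (hs.1.isOpen.mem_nhds hx)).mfderiv_eq, h hx]
  exact hs.2 x hx

theorem disjoint_ker_mfderiv (hs : IsIntegralSection B p D U s) (hx : x ∈ U)
    (hp : MDifferentiableAt 𝓘(ℝ, H) 𝓘(ℝ, B) p (s x)) :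
    Disjoint (D (s x)) (mfderiv 𝓘(ℝ, H) 𝓘(ℝ, B) p (s x)).ker := by
  rw [Submodule.disjoint_def, ← hs.2 x hx]
  rintro _ ⟨v, rfl⟩ hv
  have hv0 : v = 0 := (hs.1.mfderiv_proj_mfderiv hx hp v).symm.trans hv
  rw [hv0, map_zero]

variable [IsManifold 𝓘(ℝ, B) ∞ M] [IsManifold 𝓘(ℝ, H) ∞ N]

theorem isIntegralSectionNear_chart (hs : IsIntegralSection B p D U s) {x₀ : M} {q₀ : N}
    (hx₀ : x₀ ∈ U) (hq₀ : s x₀ = q₀)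
    {V : Type*} [NormedAddCommGroup V] [NormedSpace ℝ V] {A : H → V →L[ℝ] H}
    (hA : ∀ᶠ q in 𝓝 q₀, (A (chartAt H q₀ q)).range =
      (D q).map (mfderiv 𝓘(ℝ, H) 𝓘(ℝ, H) (chartAt H q₀) q).toLinearMap) :
    IsIntegralSectionNear A (chartAt B x₀ ∘ p ∘ (chartAt H q₀).symm)
      (chartAt H q₀ ∘ s ∘ (chartAt B x₀).symm) (chartAt B x₀ x₀) := by
  subst hq₀
  set c := chartAt B x₀
  set e := chartAt H (s x₀)
  have hc : c.MDifferentiable 𝓘(ℝ, B) 𝓘(ℝ, B) := mdifferentiable_chart x₀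
  have he : e.MDifferentiable 𝓘(ℝ, H) 𝓘(ℝ, H) := mdifferentiable_chart (s x₀)
  have hgood : ∀ᶠ x in 𝓝 x₀, x ∈ U ∧ s x ∈ e.source ∧
      (A (e (s x))).range = (D (s x)).map (mfderiv 𝓘(ℝ, H) 𝓘(ℝ, H) e (s x)).toLinearMap := by
    have hsc := (hs.1.mdifferentiableAt hx₀).continuousAt
    filter_upwards [hs.1.isOpen.mem_nhds hx₀, hsc.eventually (chart_source_mem_nhds H (s x₀)),
      hsc.eventually hA] with x hxU hxe hxA using ⟨hxU, hxe, hxA⟩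
  have hgood' := (c.symm.continuousAt (mem_chart_target B x₀)).eventually
    (by rwa [c.left_inv (mem_chart_source B x₀)])
  filter_upwards [hgood', c.open_target.mem_nhds (mem_chart_target B x₀)] with y ⟨hyU, hye, hyA⟩ hy
  have hsy := (hs.1.mdifferentiableAt hyU).comp y (hc.symm.mdifferentiableAt hy)
  have hesy := (he.mdifferentiableAt hye).comp y hsy
  refine ⟨hesy.differentiableAt, ?_, ?_⟩
  · simp only [Function.comp_apply, e.left_inv hye, hs.1.proj_eq _ hyU, c.right_inv hy]
  · have hchain : fderiv ℝ (e ∘ s ∘ c.symm) y =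
        (mfderiv 𝓘(ℝ, H) 𝓘(ℝ, H) e (s (c.symm y))).comp
          ((mfderiv 𝓘(ℝ, B) 𝓘(ℝ, H) s (c.symm y)).comp (mfderiv 𝓘(ℝ, B) 𝓘(ℝ, B) c.symm y)) := by
      rw [← mfderiv_eq_fderiv, mfderiv_comp y (he.mdifferentiableAt hye) hsy,
        mfderiv_comp y (hs.1.mdifferentiableAt hyU) (hc.symm.mdifferentiableAt hy)]
      rfl
    have hrange := hs.2 _ hyU
    rw [← LinearMap.range_comp_of_range_eq_top _ (hc.symm.range_mfderiv_eq_top hy)] at hrange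
    rw [hchain]
    refine Eq.trans ?_ hyA.symm
    rw [← hrange, ← LinearMap.range_comp]
    rfl

theorem eventuallyEq {k : ℕ} {s' : M → N} {U' : Set M}
    (hs : IsIntegralSection B p D U s) (hs' : IsIntegralSection B p D U' s')
    (hp : ContMDiff 𝓘(ℝ, H) 𝓘(ℝ, B) ∞ p) (hD : D.IsDistribution k) (hx : x ∈ U) (hx' : x ∈ U')
    (hss' : s x = s' x) : s =ᶠ[𝓝 x] s' := by
  obtain ⟨A, hA, hinj, hrange⟩ := hD.exists_frame_chart (s x)
  set c := chartAt B x
  set e := chartAt H (s x)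
  have hcx : c.symm (c x) = x := c.left_inv (mem_chart_source B x)
  have hchart : e ∘ s ∘ c.symm =ᶠ[𝓝 (c x)] e ∘ s' ∘ c.symm := by
    have hf := hs.isIntegralSectionNear_chart hx rfl hrange
    have hg := hs'.isIntegralSectionNear_chart hx' hss'.symm hrange
    have hvalue : (e ∘ s ∘ c.symm) (c x) = e (s x) := congrArg (e ∘ s) hcx
    have hvalue' : (e ∘ s' ∘ c.symm) (c x) = e (s x) := by
      rw [hss']
      exact congrArg (e ∘ s') hcx
    have hP : ContDiffAt ℝ 2 (c ∘ p ∘ e.symm) (e (s x)) :=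
      (hs.1.contDiffAt_proj_chart hx hp.contMDiffAt).of_le (WithTop.coe_le_coe.2 le_top)
    rw [← hvalue] at hA hinj hP
    exact hf.eventuallyEq hg (hvalue.trans hvalue'.symm) (hA.of_le (by simp)) hP hinj
  have hsource : ∀ᶠ y in 𝓝 x, s y ∈ e.source :=
    (hs.1.mdifferentiableAt hx).continuousAt.eventually (chart_source_mem_nhds H (s x))
  have hsource' : ∀ᶠ y in 𝓝 x, s' y ∈ e.source :=
    (hs'.1.mdifferentiableAt hx').continuousAt.eventually
      (hss' ▸ chart_source_mem_nhds H (s x))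
  filter_upwards [(c.continuousAt (mem_chart_source B x)).eventually hchart, hsource, hsource',
    chart_source_mem_nhds B x] with y hy hsy hsy' hyc
  simp only [Function.comp_apply, c.left_inv hyc] at hy
  exact e.injOn hsy hsy' hy

end IsIntegralSection

end IntegralSections

section Pushforward

variable {B H H' M N N' : Type*} [NormedAddCommGroup B] [NormedSpace ℝ B]
  [NormedAddCommGroup H] [NormedSpace ℝ H] [NormedAddCommGroup H'] [NormedSpace ℝ H']
  [TopologicalSpace M] [ChartedSpace B M] [TopologicalSpace N] [ChartedSpace H N]
  [TopologicalSpace N'] [ChartedSpace H' N']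
  {D : SubspaceField H N} {f : N → N'}

theorem IsIntegralSection.comp_left {p : N → M} {p' : N' → M} {D' : SubspaceField H' N'}
    {U : Set M} {s : M → N} (hs : IsIntegralSection B p D U s)
    (hf : ContMDiff 𝓘(ℝ, H) 𝓘(ℝ, H') ∞ f) (hp : ∀ q, p' (f q) = p q)
    (hD' : ∀ x ∈ U, D' (f (s x)) =
      (D (s x)).map (mfderiv 𝓘(ℝ, H) 𝓘(ℝ, H') f (s x)).toLinearMap) :
    IsIntegralSection B p' D' U (f ∘ s) := by
  refine ⟨⟨hs.1.isOpen, hf.comp_contMDiffOn hs.1.contMDiffOn,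
    fun x hx => (hp _).trans (hs.1.proj_eq x hx)⟩, fun x hx => ?_⟩
  rw [mfderiv_comp x ((hf (s x)).mdifferentiableAt (by simp)) (hs.1.mdifferentiableAt hx),
    Function.comp_apply, hD' x hx, ← hs.2 x hx]
  exact LinearMap.range_comp _ _

theorem SubspaceField.IsDistribution.map_of_leftInverse [IsManifold 𝓘(ℝ, H) ∞ N]
    [IsManifold 𝓘(ℝ, H') ∞ N'] {k : ℕ} (hD : D.IsDistribution k) {D' : SubspaceField H' N'}
    {g : N' → N}
    (hf : ContMDiff 𝓘(ℝ, H) 𝓘(ℝ, H') ∞ f) (hg : ContMDiff 𝓘(ℝ, H') 𝓘(ℝ, H) ∞ g)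
    (hfg : Function.LeftInverse f g)
    (hdisj : ∀ q, Disjoint (D (g q)) (mfderiv 𝓘(ℝ, H) 𝓘(ℝ, H') f (g q)).ker)
    (hD' : ∀ q, D' q = (D (g q)).map (mfderiv 𝓘(ℝ, H) 𝓘(ℝ, H') f (g q)).toLinearMap) :
    D'.IsDistribution k := by
  intro q₀
  obtain ⟨U, hU, hq₀, X, hX, hframe⟩ := hD (g q₀)
  refine ⟨g ⁻¹' U, hU.preimage hg.continuous, hq₀,
    fun i q => (mfderiv 𝓘(ℝ, H) 𝓘(ℝ, H') f (g q) (X i (g q)) : H'), fun i => ?_, fun q hq => ?_⟩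
  · have hTf : ContMDiff 𝓘(ℝ, H).tangent 𝓘(ℝ, H').tangent ∞ (tangentMap 𝓘(ℝ, H) 𝓘(ℝ, H') f) :=
      hf.contMDiff_tangentMap (by simp)
    refine (hTf.comp_contMDiffOn ((hX i).comp hg.contMDiffOn subset_rfl)).congr fun q _ => ?_
    have hpoint (a b : N') (hab : a = b) (w : H') :
        (⟨b, w⟩ : TangentBundle 𝓘(ℝ, H') N') = ⟨a, w⟩ := by
      subst hab
      rfl
    exact hpoint _ _ (hfg q) _
  · obtain ⟨hindep, hspan⟩ := hframe _ hq
    refine ⟨hindep.map (by rw [hspan]; exact hdisj q), ?_⟩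
    rw [hD', ← hspan, Submodule.map_span, ← Set.range_comp]
    rfl

end Pushforward

section FormsInCharts

variable {H N : Type*} [NormedAddCommGroup H] [NormedSpace ℝ H]
  [TopologicalSpace N] [ChartedSpace H N]

/-- The value of a differential form at a point, as an alternating form on the model space, to which
the tangent spaces reduce by definition. -/
def DiffForm.valueAt {k : ℕ} (α : DiffForm H N k) (p : N) : H [⋀^Fin k]→L[ℝ] ℝ := α p

theorem DiffForm.apply_congr {k : ℕ} (α : DiffForm H N k) {p q : N} (h : p = q) (v : Fin k → H) :
    (α p : H [⋀^Fin k]→L[ℝ] ℝ) v = (α q : H [⋀^Fin k]→L[ℝ] ℝ) v := by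
  rw [h]

variable {e e' : OpenPartialHomeomorph N H}

theorem contDiffOn_comp_symm_of_mem_maximalAtlas (he : e ∈ IsManifold.maximalAtlas 𝓘(ℝ, H) ∞ N)
    (he' : e' ∈ IsManifold.maximalAtlas 𝓘(ℝ, H) ∞ N) :
    ContDiffOn ℝ ∞ (e' ∘ e.symm) (e.symm.trans e').source :=
  ((contMDiffOn_of_mem_maximalAtlas he').comp
    ((contMDiffOn_symm_of_mem_maximalAtlas he).mono fun _ hx => hx.1) fun _ hx => hx.2).contDiffOn

theorem DiffForm.inChart_eq_compContinuousLinearMap {k : ℕ} (α : DiffForm H N k)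
    (he : e ∈ IsManifold.maximalAtlas 𝓘(ℝ, H) ∞ N) (he' : e' ∈ IsManifold.maximalAtlas 𝓘(ℝ, H) ∞ N)
    {y : H} (hy : y ∈ (e.symm.trans e').source) :
    α.inChart e y = (α.inChart e' ((e' ∘ e.symm) y)).compContinuousLinearMap
      (fderiv ℝ (e' ∘ e.symm) y) := by
  have hopen := (e.symm.trans e').open_source
  have hτ : MDifferentiableAt 𝓘(ℝ, H) 𝓘(ℝ, H) (e' ∘ e.symm) y :=
    (((contDiffOn_comp_symm_of_mem_maximalAtlas he he').contDiffAt
      (hopen.mem_nhds hy)).differentiableAt (by simp)).mdifferentiableAt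
  have he'symm : MDifferentiableAt 𝓘(ℝ, H) 𝓘(ℝ, H) e'.symm ((e' ∘ e.symm) y) :=
    (contMDiffAt_symm_of_mem_maximalAtlas he' (e'.map_source hy.2)).mdifferentiableAt (by simp)
  have hcomp : e'.symm ∘ e' ∘ e.symm =ᶠ[𝓝 y] e.symm := by
    filter_upwards [hopen.mem_nhds hy] with x hx using e'.left_inv hx.2
  have hderiv := mfderiv_comp y he'symm hτ
  rw [hcomp.mfderiv_eq, mfderiv_eq_fderiv] at hderiv
  ext v
  refine (α.apply_congr (e'.left_inv hy.2).symm _).trans ?_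
  exact congrArg (α _ : H [⋀^Fin k]→L[ℝ] ℝ) (funext fun i => DFunLike.congr_fun hderiv (v i))

variable [IsManifold 𝓘(ℝ, H) ∞ N]

theorem DiffForm.IsSmooth.differentiableAt_inChart {k : ℕ} {α : DiffForm H N k} (hα : α.IsSmooth)
    (he : e ∈ IsManifold.maximalAtlas 𝓘(ℝ, H) ∞ N) {y : H} (hy : y ∈ e.target) :
    DifferentiableAt ℝ (α.inChart e) y := by
  let e' := chartAt H (e.symm y)
  have he' : e' ∈ IsManifold.maximalAtlas 𝓘(ℝ, H) ∞ N := IsManifold.chart_mem_maximalAtlas _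
  have hy' : (e.symm.trans e').source ∈ 𝓝 y :=
    (e.symm.trans e').open_source.mem_nhds ⟨hy, mem_chart_source H (e.symm y)⟩
  have hτ : ContDiffAt ℝ ∞ (e' ∘ e.symm) y :=
    (contDiffOn_comp_symm_of_mem_maximalAtlas he he').contDiffAt hy'
  have hα' : DifferentiableAt ℝ (α.inChart e') ((e' ∘ e.symm) y) :=
    ((hα e' (chart_mem_atlas H _)).contDiffAt
      (chart_target_mem_nhds H (e.symm y))).differentiableAt (by simp)
  have hdτ : DifferentiableAt ℝ (fderiv ℝ (e' ∘ e.symm)) y :=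
    (hτ.fderiv_right (m := 1) (by norm_cast)).differentiableAt (by simp)
  refine ((hα'.comp y (hτ.differentiableAt
    (by simp))).continuousAlternatingMapCompContinuousLinearMap hdτ).congr_of_eventuallyEq ?_
  filter_upwards [hy'] with x hx using α.inChart_eq_compContinuousLinearMap he he' hx

end FormsInCharts

section JetCoordinates

variable {B F M E : Type*}
  [NormedAddCommGroup B] [NormedSpace ℝ B]
  [NormedAddCommGroup F] [NormedSpace ℝ F]
  [TopologicalSpace M] [ChartedSpace B M]
  [TopologicalSpace E] [ChartedSpace (B × F) E]
  {π : SmoothBundle B F M E}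

namespace AdaptedChart

theorem dTot_dTotSymm (A : AdaptedChart π) {u : E} (hu : u ∈ A.tot.source) (v : B × F) :
    A.dTot u (A.dTotSymm (A.tot u) v) = v := by
  have h := DFunLike.congr_fun (A.dTot_comp_dTotSymm_self (A.tot.map_source hu)) v
  rwa [A.tot.left_inv hu] at h

theorem dBase_injective (A : AdaptedChart π) {x : M} (hx : x ∈ A.base.source) :
    Function.Injective (A.dBase x) :=
  Function.LeftInverse.injective (g := A.dBaseSymm (A.base x)) fun v =>
    DFunLike.congr_fun (A.dBaseSymm_comp_dBase_self hx) v

theorem dBase_dBaseSymm (A : AdaptedChart π) {x : M} (hx : x ∈ A.base.source) (v : B) :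
    A.dBase x (A.dBaseSymm (A.base x) v) = v := by
  have h := DFunLike.congr_fun (A.dBase_comp_dBaseSymm_self (A.base.map_source hx)) v
  rwa [A.base.left_inv hx] at h

/-- The coordinate expression of the vertical space `V_uπ`. -/
def verticalCoord (A : AdaptedChart π) (u : E) : π.vertical u →L[ℝ] F :=
  ContinuousLinearMap.snd ℝ B F ∘L A.dTot u ∘L (π.vertical u).subtypeL

/-- The coordinate expression of the elements of the vector space `Hom(T_{π u}M, V_uπ)` on which
`J¹_uπ` is modelled. -/
def vertCoord (A : AdaptedChart π) (u : E) : (B →L[ℝ] π.vertical u) →L[ℝ] B →L[ℝ] F :=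
  ContinuousLinearMap.compL ℝ B (π.vertical u) F (A.verticalCoord u) ∘L
    (ContinuousLinearMap.compL ℝ B B (π.vertical u)).flip (A.dBaseSymm (A.base (π.proj u)))

theorem velocity_apply (A : AdaptedChart π) (j : FirstJet π) (v : B) :
    A.velocity j v = (A.dTot j.pt (j.horMap (A.dBaseSymm (A.base (π.proj j.pt)) v))).2 := rfl

variable [IsManifold 𝓘(ℝ, B) ∞ M] [IsManifold 𝓘(ℝ, B × F) ∞ E]

theorem dTot_fst (A : AdaptedChart π) {u : E} (hu : u ∈ A.tot.source) (v : B × F) :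
    (A.dTot u v).1 = A.dBase (π.proj u) (π.dProj u v) :=
  DFunLike.congr_fun (A.fst_comp_dTot hu) v

theorem vertCoord_surjective (A : AdaptedChart π) {u : E} (hu : u ∈ A.tot.source) :
    Function.Surjective (A.vertCoord u) := by
  intro q
  have hx := A.proj_mem u hu
  let ψ : B →L[ℝ] B × F := A.dTotSymm (A.tot u) ∘L ContinuousLinearMap.inr ℝ B F ∘L q ∘L
    A.dBase (π.proj u)
  have hψ (v : B) : A.dTot u (ψ v) = (0, q (A.dBase (π.proj u) v)) := A.dTot_dTotSymm hu _
  have hvert (v : B) : ψ v ∈ π.vertical u := by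
    apply A.dBase_injective hx
    have h := A.dTot_fst hu (ψ v)
    rw [hψ] at h
    rw [map_zero]
    exact h.symm
  refine ⟨ψ.codRestrict (π.vertical u) hvert, ?_⟩
  ext v
  change (A.dTot u (ψ _)).2 = _
  rw [hψ]
  exact congrArg q (A.dBase_dBaseSymm hx v)

end AdaptedChart

namespace FirstJet

variable {j₀ j : FirstJet π}

section

variable [IsManifold 𝓘(ℝ, B × F) ∞ E]

/-- The adapted chart of `E` that induces the preferred chart of `J¹π` at `j`. -/
def adaptedChart (j : FirstJet π) : AdaptedChart π := (π.exists_adaptedChart j.pt).choose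

theorem pt_mem_adaptedChart_source (j : FirstJet π) : j.pt ∈ j.adaptedChart.tot.source :=
  (π.exists_adaptedChart j.pt).choose_spec

end

variable [IsManifold 𝓘(ℝ, B) ∞ M] [IsManifold 𝓘(ℝ, B × F) ∞ E]

theorem chartAt_apply (j₀ j : FirstJet π) :
    chartAt (JetModel B F) j₀ j = (j₀.adaptedChart.tot j.pt, j₀.adaptedChart.velocity j) := rfl

theorem mem_chartAt_source :
    j ∈ (chartAt (JetModel B F) j₀).source ↔ j.pt ∈ j₀.adaptedChart.tot.source := Iff.rfl

theorem eq_of_pt_eq_of_chartAt_eq {j' : FirstJet π} (hj : j ∈ (chartAt (JetModel B F) j₀).source)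
    (hpt : j.pt = j'.pt) (hchart : chartAt (JetModel B F) j₀ j = chartAt (JetModel B F) j₀ j') :
    j = j' := by
  refine (chartAt (JetModel B F) j₀).injOn hj ?_ hchart
  rw [mem_chartAt_source] at hj ⊢
  rwa [← hpt]

theorem contMDiff_pt : ContMDiff 𝓘(ℝ, JetModel B F) 𝓘(ℝ, B × F) ∞ (FirstJet.pt (π := π)) := by
  intro j
  have hchart : ContMDiffAt 𝓘(ℝ, JetModel B F) 𝓘(ℝ, JetModel B F) ∞ (chartAt (JetModel B F) j) j :=
    contMDiffOn_chart.contMDiffAt (chart_source_mem_nhds _ j)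
  have hfst : ContMDiff 𝓘(ℝ, JetModel B F) 𝓘(ℝ, B × F) ∞ (Prod.fst : JetModel B F → B × F) :=
    contDiff_fst.contMDiff
  have htot : ContMDiffAt 𝓘(ℝ, B × F) 𝓘(ℝ, B × F) ∞ j.adaptedChart.tot.symm
      (j.adaptedChart.tot j.pt) :=
    contMDiffAt_symm_of_mem_maximalAtlas j.adaptedChart.tot_mem
      (j.adaptedChart.tot.map_source j.pt_mem_adaptedChart_source)
  refine (ContMDiffAt.comp (x := j) (g := j.adaptedChart.tot.symm)
    (f := Prod.fst ∘ chartAt (JetModel B F) j) htot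
      (hfst.contMDiffAt.comp j hchart)).congr_of_eventuallyEq ?_
  filter_upwards [chart_source_mem_nhds (JetModel B F) j] with i hi
  exact (j.adaptedChart.tot.left_inv hi).symm

theorem mdifferentiableAt_pt (j : FirstJet π) :
    MDifferentiableAt 𝓘(ℝ, JetModel B F) 𝓘(ℝ, B × F) (FirstJet.pt (π := π)) j :=
  (contMDiff_pt j).mdifferentiableAt (by simp)

theorem contMDiff_projBase :
    ContMDiff 𝓘(ℝ, JetModel B F) 𝓘(ℝ, B) ∞ (FirstJet.projBase (π := π)) :=
  π.contMDiff.comp contMDiff_pt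

theorem dProjBase_eq (j : FirstJet π) : j.dProjBase = π.dProj j.pt ∘L j.dPt :=
  mfderiv_comp j (π.mdifferentiableAt j.pt) j.mdifferentiableAt_pt

/-- The tangent map at `j` of the preferred chart of `J¹π` at `j₀`. -/
def dChart (j₀ j : FirstJet π) : JetModel B F →L[ℝ] JetModel B F :=
  mfderiv 𝓘(ℝ, JetModel B F) 𝓘(ℝ, JetModel B F) (chartAt (JetModel B F) j₀) j

/-- The tangent map at `z` of the inverse of the preferred chart of `J¹π` at `j₀`. -/
def dChartSymm (j₀ : FirstJet π) (z : JetModel B F) : JetModel B F →L[ℝ] JetModel B F :=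
  mfderiv 𝓘(ℝ, JetModel B F) 𝓘(ℝ, JetModel B F) (chartAt (JetModel B F) j₀).symm z

theorem mdifferentiable_chartAt (j₀ : FirstJet π) :
    (chartAt (JetModel B F) j₀).MDifferentiable 𝓘(ℝ, JetModel B F) 𝓘(ℝ, JetModel B F) :=
  haveI : IsManifold 𝓘(ℝ, JetModel B F) 1 (FirstJet π) := .of_le (n := ∞) (by simp)
  mdifferentiable_chart j₀

theorem dChart_dChartSymm {z : JetModel B F} (hz : z ∈ (chartAt (JetModel B F) j₀).target)
    (v : JetModel B F) :
    dChart j₀ ((chartAt (JetModel B F) j₀).symm z) (dChartSymm j₀ z v) = v :=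
  DFunLike.congr_fun ((mdifferentiable_chartAt j₀).comp_symm_deriv hz) v

theorem dChartSymm_dChart (hj : j ∈ (chartAt (JetModel B F) j₀).source) (v : JetModel B F) :
    dChartSymm j₀ (chartAt (JetModel B F) j₀ j) (dChart j₀ j v) = v :=
  DFunLike.congr_fun ((mdifferentiable_chartAt j₀).symm_comp_deriv hj) v

theorem dChart_fst (hj : j ∈ (chartAt (JetModel B F) j₀).source) (w : JetModel B F) :
    (dChart j₀ j w).1 = j₀.adaptedChart.dTot j.pt (j.dPt w) := by
  have hfst : MDifferentiableAt 𝓘(ℝ, JetModel B F) 𝓘(ℝ, B × F) (Prod.fst : JetModel B F → B × F)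
      (chartAt (JetModel B F) j₀ j) := differentiableAt_fst.mdifferentiableAt
  have htot := mfderiv_comp j (j₀.adaptedChart.mdiff_tot hj) j.mdifferentiableAt_pt
  have hchart := mfderiv_comp j hfst ((mdifferentiable_chartAt j₀).mdifferentiableAt hj)
  have heq : j₀.adaptedChart.tot ∘ FirstJet.pt = Prod.fst ∘ chartAt (JetModel B F) j₀ := rfl
  rw [heq, hchart, mfderiv_eq_fderiv, fderiv_fst] at htot
  exact DFunLike.congr_fun htot w

theorem dChart_fst_fst (hj : j ∈ (chartAt (JetModel B F) j₀).source) (w : JetModel B F) :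
    (dChart j₀ j w).1.1 = j₀.adaptedChart.dBase j.projBase (j.dProjBase w) := by
  rw [dChart_fst hj, j₀.adaptedChart.dTot_fst hj, dProjBase_eq]
  rfl

theorem dProjBase_eq_dBaseSymm (hj : j ∈ (chartAt (JetModel B F) j₀).source) (w : JetModel B F) :
    j.dProjBase w =
      j₀.adaptedChart.dBaseSymm (j₀.adaptedChart.base j.projBase) (dChart j₀ j w).1.1 := by
  have hx : j.projBase ∈ j₀.adaptedChart.base.source := j₀.adaptedChart.proj_mem _ hj
  rw [dChart_fst_fst hj]
  exact (DFunLike.congr_fun (j₀.adaptedChart.dBaseSymm_comp_dBase_self hx) _).symm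

end FirstJet

section Translation

variable [FiniteDimensional ℝ B] [IsManifold 𝓘(ℝ, B) ∞ M] [IsManifold 𝓘(ℝ, B × F) ∞ E]

theorem AdaptedChart.velocity_translate (A : AdaptedChart π) (j : FirstJet π)
    (φ : B →L[ℝ] π.vertical j.pt) :
    A.velocity (j.translate φ) = A.velocity j + A.vertCoord j.pt φ := by
  ext v
  have h : A.velocity (j.translate φ) v = (A.dTot j.pt
    (j.horMap (A.dBaseSymm (A.base (π.proj j.pt)) v) +
      (φ (A.dBaseSymm (A.base (π.proj j.pt)) v) : B × F))).2 := rfl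
  rw [h, map_add]
  rfl

namespace FirstJet

variable {j₀ j : FirstJet π}

theorem chartAt_translate (j₀ j : FirstJet π) (φ : B →L[ℝ] π.vertical j.pt) :
    chartAt (JetModel B F) j₀ (j.translate φ) =
      chartAt (JetModel B F) j₀ j + (0, j₀.adaptedChart.vertCoord j.pt φ) := by
  rw [chartAt_apply, chartAt_apply, AdaptedChart.velocity_translate]
  exact Prod.ext (add_zero _).symm rfl

theorem translate_zero (j : FirstJet π) : j.translate 0 = j :=
  FirstJet.ext_of_eq rfl (by
    change j.horMap + _ = j.horMap
    rw [ContinuousLinearMap.comp_zero, add_zero])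

theorem coe_structureForm (j : FirstJet π) (w : JetModel B F) :
    (j.structureForm w : B × F) = j.dPt w - j.horMap (j.dProjBase w) := by
  rw [dProjBase_eq]
  rfl

theorem verticalCoord_structureForm (hj : j ∈ (chartAt (JetModel B F) j₀).source)
    (w : JetModel B F) : j₀.adaptedChart.verticalCoord j.pt (j.structureForm w) =
      (dChart j₀ j w).1.2 - j₀.adaptedChart.velocity j (dChart j₀ j w).1.1 := by
  change (j₀.adaptedChart.dTot j.pt (j.structureForm w : B × F)).2 = _
  rw [coe_structureForm, map_sub, AdaptedChart.velocity_apply, dProjBase_eq_dBaseSymm hj,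
    dChart_fst hj]
  rfl

end FirstJet

end Translation

end JetCoordinates

theorem fderiv_fderiv_add_clm_comp {V H : Type*} [NormedAddCommGroup V] [NormedSpace ℝ V]
    [NormedAddCommGroup H] [NormedSpace ℝ H] {g : H → ℝ} {z : H}
    (hg : DifferentiableAt ℝ (fderiv ℝ g) z) (T : V →L[ℝ] H) (φ χ : V) :
    fderiv ℝ (fun φ => (fderiv ℝ g (z + T φ)) ∘L T) 0 φ χ =
      fderiv ℝ (fderiv ℝ g) z (T φ) (T χ) := by
  have haff : HasFDerivAt (fun φ => z + T φ) T 0 := T.hasFDerivAt.const_add _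
  have hdg : HasFDerivAt (fderiv ℝ g) (fderiv ℝ (fderiv ℝ g) z) (z + T 0) := by
    rw [map_zero, add_zero]
    exact hg.hasFDerivAt
  have hcomp : HasFDerivAt (fun φ => (fderiv ℝ g (z + T φ)) ∘L T) _ 0 :=
    (hdg.comp 0 haff).clm_comp (hasFDerivAt_const T 0)
  rw [hcomp.fderiv]
  simp

section LagrangianInCharts

variable {B F M E : Type*}
  [NormedAddCommGroup B] [NormedSpace ℝ B]
  [NormedAddCommGroup F] [NormedSpace ℝ F]
  [TopologicalSpace M] [ChartedSpace B M] [IsManifold 𝓘(ℝ, B) ∞ M]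
  [TopologicalSpace E] [ChartedSpace (B × F) E] [IsManifold 𝓘(ℝ, B × F) ∞ E]
  {π : SmoothBundle B F M E} {L : FirstJet π → ℝ} {j₀ j : FirstJet π}

/-- The Lagrangian function in the preferred chart of `J¹π` at `j₀`. -/
def lagrangianInChart (L : FirstJet π → ℝ) (j₀ : FirstJet π) : JetModel B F → ℝ :=
  L ∘ (chartAt (JetModel B F) j₀).symm

theorem contDiffAt_lagrangianInChart (hL : ContMDiff 𝓘(ℝ, JetModel B F) 𝓘(ℝ, ℝ) ∞ L)
    {z : JetModel B F} (hz : z ∈ (chartAt (JetModel B F) j₀).target) :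
    ContDiffAt ℝ ∞ (lagrangianInChart L j₀) z :=
  (hL.contMDiffAt.comp z (contMDiffAt_symm_of_mem_maximalAtlas (n := ∞)
    (IsManifold.chart_mem_maximalAtlas j₀) hz)).contDiffAt

variable [FiniteDimensional ℝ B]

theorem fderiv_comp_translate (hL : ContMDiff 𝓘(ℝ, JetModel B F) 𝓘(ℝ, ℝ) ∞ L)
    (hj : j ∈ (chartAt (JetModel B F) j₀).source) (φ : B →L[ℝ] π.vertical j.pt) :
    fderiv ℝ (fun φ => L (j.translate φ)) φ =
      fderiv ℝ (lagrangianInChart L j₀) (chartAt (JetModel B F) j₀ (j.translate φ)) ∘L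
        ContinuousLinearMap.inr ℝ (B × F) (B →L[ℝ] F) ∘L j₀.adaptedChart.vertCoord j.pt := by
  have hmem (φ) : j.translate φ ∈ (chartAt (JetModel B F) j₀).source := hj
  have hLchart : (fun φ => L (j.translate φ)) = lagrangianInChart L j₀ ∘ fun φ =>
      chartAt (JetModel B F) j₀ j + (0, j₀.adaptedChart.vertCoord j.pt φ) := by
    funext φ
    rw [Function.comp_apply, ← FirstJet.chartAt_translate]
    exact congrArg L ((chartAt (JetModel B F) j₀).left_inv (hmem φ)).symm
  have haff : HasFDerivAt (fun φ => chartAt (JetModel B F) j₀ j +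
      ((0 : B × F), j₀.adaptedChart.vertCoord j.pt φ))
      (ContinuousLinearMap.inr ℝ (B × F) (B →L[ℝ] F) ∘L j₀.adaptedChart.vertCoord j.pt) φ :=
    ((ContinuousLinearMap.inr ℝ (B × F) (B →L[ℝ] F) ∘L
      j₀.adaptedChart.vertCoord j.pt).hasFDerivAt).const_add _
  have hdiff := (contDiffAt_lagrangianInChart hL
    ((chartAt (JetModel B F) j₀).map_source (hmem φ))).differentiableAt (by simp)
  rw [FirstJet.chartAt_translate] at hdiff ⊢
  rw [hLchart, (hdiff.hasFDerivAt.comp φ haff).fderiv]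

theorem verticalDeriv_eq (hL : ContMDiff 𝓘(ℝ, JetModel B F) 𝓘(ℝ, ℝ) ∞ L)
    (hj : j ∈ (chartAt (JetModel B F) j₀).source) :
    verticalDeriv L j = fderiv ℝ (lagrangianInChart L j₀) (chartAt (JetModel B F) j₀ j) ∘L
      ContinuousLinearMap.inr ℝ (B × F) (B →L[ℝ] F) ∘L j₀.adaptedChart.vertCoord j.pt := by
  have h := fderiv_comp_translate hL hj 0
  rwa [FirstJet.translate_zero] at h

theorem verticalHessian_apply (hL : ContMDiff 𝓘(ℝ, JetModel B F) 𝓘(ℝ, ℝ) ∞ L)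
    (hj : j ∈ (chartAt (JetModel B F) j₀).source) (φ χ : B →L[ℝ] π.vertical j.pt) :
    verticalHessian L j φ χ =
      fderiv ℝ (fderiv ℝ (lagrangianInChart L j₀)) (chartAt (JetModel B F) j₀ j)
        (0, j₀.adaptedChart.vertCoord j.pt φ) (0, j₀.adaptedChart.vertCoord j.pt χ) := by
  let T := ContinuousLinearMap.inr ℝ (B × F) (B →L[ℝ] F) ∘L j₀.adaptedChart.vertCoord j.pt
  have hfderiv : fderiv ℝ (fun φ => L (j.translate φ)) = fun φ =>
      (fderiv ℝ (lagrangianInChart L j₀) (chartAt (JetModel B F) j₀ j + T φ)) ∘L T := by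
    funext φ
    rw [fderiv_comp_translate hL hj, FirstJet.chartAt_translate]
    rfl
  unfold verticalHessian
  rw [hfderiv]
  exact fderiv_fderiv_add_clm_comp ((contDiffAt_lagrangianInChart hL
      ((chartAt (JetModel B F) j₀).map_source hj)).fderiv_right (m := 1)
        (by norm_cast) |>.differentiableAt (by simp)) T φ χ

end LagrangianInCharts

section AlternatingForms

variable {V V' : Type*} [NormedAddCommGroup V] [NormedSpace ℝ V]
  [NormedAddCommGroup V'] [NormedSpace ℝ V'] {m : ℕ}

theorem alternating_toContinuousLinearMap_eq_zero (η : V [⋀^Fin m]→L[ℝ] ℝ) {v : Fin m → V}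
    {k l : Fin m} (hlk : l ≠ k) (hl : v l = 0) : η.toContinuousLinearMap v k = 0 := by
  ext X
  refine η.map_coord_zero (m := Function.update v k X) l ?_
  rw [Function.update_of_ne hlk, hl]

theorem alternating_toContinuousLinearMap_congr (η : V [⋀^Fin m]→L[ℝ] ℝ) {v w : Fin m → V}
    {k : Fin m} (h : ∀ i ≠ k, v i = w i) :
    η.toContinuousLinearMap v k = η.toContinuousLinearMap w k := by
  ext X
  refine congrArg η (funext fun i => ?_)
  by_cases hi : i = k
  · rw [hi, Function.update_self, Function.update_self]
  · rw [Function.update_of_ne hi, Function.update_of_ne hi, h i hi]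

theorem compContinuousLinearMap_toContinuousLinearMap (η : V [⋀^Fin m]→L[ℝ] ℝ) (S : V' →L[ℝ] V)
    (v : Fin m → V') (k : Fin m) :
    (η.compContinuousLinearMap S).toContinuousLinearMap v k =
      η.toContinuousLinearMap (S ∘ v) k ∘L S := by
  ext X
  exact congrArg η (Function.comp_update S v k X)

theorem alternating_toContinuousLinearMap_basis [FiniteDimensional ℝ V] (η : V [⋀^Fin m]→L[ℝ] ℝ)
    (b : Module.Basis (Fin m) ℝ V) (k : Fin m) :
    η.toContinuousLinearMap b k = η b • (b.coord k).toContinuousLinearMap := by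
  apply ContinuousLinearMap.coe_injective
  refine b.ext fun j => ?_
  change η (Function.update b k (b j)) = η b * b.repr (b j) k
  by_cases hj : j = k
  · simp [hj]
  · rw [b.repr_self, Finsupp.single_eq_of_ne (Ne.symm hj), mul_zero]
    refine η.map_eq_zero_of_eq _ (i := k) (j := j) ?_ (Ne.symm hj)
    simp [Function.update_of_ne hj]

theorem sum_coord_smulRight {ι W : Type*} [Fintype ι] [FiniteDimensional ℝ V]
    [NormedAddCommGroup W] [NormedSpace ℝ W] (b : Module.Basis ι ℝ V) (χ : V →L[ℝ] W) :
    ∑ k, (b.coord k).toContinuousLinearMap.smulRight (χ (b k)) = χ := by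
  ext X
  simp only [_root_.sum_apply, ContinuousLinearMap.smulRight_apply,
    LinearMap.coe_toContinuousLinearMap', Module.Basis.coord_apply]
  simp only [← map_smul, ← map_sum, b.sum_repr]

variable {Z : Type*} [NormedAddCommGroup Z] [NormedSpace ℝ Z] {z : Z}

theorem differentiableAt_continuousLinearMap_of_apply [FiniteDimensional ℝ V] {W : Type*}
    [NormedAddCommGroup W] [NormedSpace ℝ W] {f : Z → V →L[ℝ] W}
    (h : ∀ X, DifferentiableAt ℝ (fun z => f z X) z) : DifferentiableAt ℝ f z := by
  let b := Module.finBasis ℝ V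
  have hf : f = fun z => ∑ k, (b.coord k).toContinuousLinearMap.smulRight (f z (b k)) :=
    funext fun z => (sum_coord_smulRight b (f z)).symm
  rw [hf]
  exact DifferentiableAt.fun_sum fun k _ =>
    ((ContinuousLinearMap.smulRightL ℝ V W
      (b.coord k).toContinuousLinearMap).differentiableAt).comp z (h (b k))

variable {β : Z → V [⋀^Fin m]→L[ℝ] ℝ}

theorem differentiableAt_continuousAlternatingMap_of_apply [FiniteDimensional ℝ V]
    (h : ∀ v : Fin m → V, DifferentiableAt ℝ (fun z => β z v) z) : DifferentiableAt ℝ β z := by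
  let b := Module.finBasis ℝ V
  let ev : (V [⋀^Fin m]→L[ℝ] ℝ) →ₗ[ℝ] (Fin m → Fin (Module.finrank ℝ V)) → ℝ :=
    { toFun := fun α σ => α fun i => b (σ i)
      map_add' := fun _ _ => rfl
      map_smul' := fun _ _ => rfl }
  have hker : ev.ker = ⊥ := by
    rw [LinearMap.ker_eq_bot']
    intro α hα
    apply ContinuousAlternatingMap.toAlternatingMap_injective
    exact b.ext_alternating fun σ _ => congrFun hα σ
  obtain ⟨g, hg⟩ := ev.exists_leftInverse_of_injective hker
  have hβ : β = fun z => g.toContinuousLinearMap (ev (β z)) :=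
    funext fun z => (LinearMap.congr_fun hg (β z)).symm
  rw [hβ]
  exact g.toContinuousLinearMap.differentiableAt.comp z (differentiableAt_pi.2 fun σ => h _)

theorem differentiableAt_alternating_toContinuousLinearMap [FiniteDimensional ℝ V]
    (hβ : DifferentiableAt ℝ β z) (v : Fin m → V) (k : Fin m) :
    DifferentiableAt ℝ (fun z => (β z).toContinuousLinearMap v k) z :=
  differentiableAt_continuousLinearMap_of_apply fun _ =>
    hβ.continuousAlternatingMap_apply fun _ => differentiableAt_const _

theorem extDeriv_cons_of_eventually_eq_zero {α : V → V [⋀^Fin m]→L[ℝ] ℝ} {x : V}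
    (hα : DifferentiableAt ℝ α x) {ξ : V}
    (hξ : ∀ᶠ y in 𝓝 x, ∀ w : Fin m → V, ∀ l, w l = ξ → α y w = 0) (v : Fin m → V) :
    extDeriv α x (Fin.cons ξ v) = fderiv ℝ (fun y => α y v) x ξ := by
  rw [extDeriv_apply hα, Fin.sum_univ_succ, Finset.sum_eq_zero, add_zero]
  · rw [Fin.val_zero, pow_zero, one_smul, Fin.cons_zero]
    rfl
  · intro i _
    obtain ⟨n, rfl⟩ : ∃ n, m = n + 1 := ⟨m - 1, by have := i.2; omega⟩
    have hzero : (fun y => α y (i.succ.removeNth (Fin.cons ξ v : Fin (n + 1 + 1) → V)))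
        =ᶠ[𝓝 x] fun _ => 0 := hξ.mono fun y hy => hy _ 0 rfl
    rw [hzero.fderiv_eq, fderiv_const_apply]
    exact smul_zero _

end AlternatingForms

section InsertionForm

variable {T B W B' W' : Type*} [NormedAddCommGroup T] [NormedSpace ℝ T]
  [NormedAddCommGroup B] [NormedSpace ℝ B] [FiniteDimensional ℝ B]
  [NormedAddCommGroup W] [NormedSpace ℝ W]
  [NormedAddCommGroup B'] [NormedSpace ℝ B'] [FiniteDimensional ℝ B']
  [NormedAddCommGroup W'] [NormedSpace ℝ W'] {m : ℕ}

theorem insertionForm_apply (η : B [⋀^Fin m]→L[ℝ] ℝ) (τ : T →L[ℝ] B) (θ : T →L[ℝ] W)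
    (ℓ : (B →L[ℝ] W) →L[ℝ] ℝ) (v : Fin m → T) :
    insertionForm η τ θ ℓ v =
      ∑ k, ℓ ((η.toContinuousLinearMap (τ ∘ v) k).smulRight (θ (v k))) := rfl

theorem insertionForm_eq_of_apply_eq_zero (η : B [⋀^Fin m]→L[ℝ] ℝ) {τ : T →L[ℝ] B}
    (θ : T →L[ℝ] W) (ℓ : (B →L[ℝ] W) →L[ℝ] ℝ) {v : Fin m → T} {k : Fin m} (hk : τ (v k) = 0) :
    insertionForm η τ θ ℓ v =
      ℓ ((η.toContinuousLinearMap (τ ∘ v) k).smulRight (θ (v k))) := by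
  rw [insertionForm_apply]
  refine Finset.sum_eq_single k (fun i _ hi => ?_) fun hk => absurd (Finset.mem_univ k) hk
  rw [alternating_toContinuousLinearMap_eq_zero η hi.symm hk]
  exact (congrArg ℓ (by ext; exact zero_smul ℝ _)).trans ℓ.map_zero

theorem insertionForm_comp_of_apply_eq (η : B [⋀^Fin m]→L[ℝ] ℝ) (S : B' →L[ℝ] B) (τ : T →L[ℝ] B')
    (θ : T →L[ℝ] W) {ℓ : (B →L[ℝ] W) →L[ℝ] ℝ} {κ : W →L[ℝ] W'} {ℓ' : (B' →L[ℝ] W') →L[ℝ] ℝ}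
    (h : ∀ A, ℓ A = ℓ' (κ ∘L A ∘L S)) :
    insertionForm η (S ∘L τ) θ ℓ =
      insertionForm (η.compContinuousLinearMap S) τ (κ ∘L θ) ℓ' := by
  ext v
  rw [insertionForm_apply, insertionForm_apply]
  refine Finset.sum_congr rfl fun k _ => ?_
  rw [h, compContinuousLinearMap_toContinuousLinearMap]
  congr 1
  ext X
  exact κ.map_smul _ _

end InsertionForm

section CartanFormInCoordinates

variable {B F : Type*} [NormedAddCommGroup B] [NormedSpace ℝ B]
  [NormedAddCommGroup F] [NormedSpace ℝ F]

/-- The coordinate expression `dx` of the tangent map of `J¹π → M`. -/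
def jetBaseCoord : JetModel B F →L[ℝ] B :=
  ContinuousLinearMap.fst ℝ B F ∘L ContinuousLinearMap.fst ℝ (B × F) (B →L[ℝ] F)

/-- The coordinate expression `du - p dx` of the structure form at the point `z = (x, u, p)`. -/
def contactForm (z : JetModel B F) : JetModel B F →L[ℝ] F :=
  ContinuousLinearMap.snd ℝ B F ∘L ContinuousLinearMap.fst ℝ (B × F) (B →L[ℝ] F) -
    z.2 ∘L jetBaseCoord

theorem contactForm_apply (z w : JetModel B F) : contactForm z w = w.1.2 - z.2 w.1.1 := rfl

variable [FiniteDimensional ℝ B] {m : ℕ}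

/-- The Cartan form of the Lagrangian function `g` with respect to the volume form `β`, in
coordinates. -/
def cartanFormCoord (β : B → B [⋀^Fin m]→L[ℝ] ℝ) (g : JetModel B F → ℝ) (z : JetModel B F) :
    JetModel B F [⋀^Fin m]→L[ℝ] ℝ :=
  insertionForm (β z.1.1) jetBaseCoord (contactForm z)
      (fderiv ℝ g z ∘L ContinuousLinearMap.inr ℝ (B × F) (B →L[ℝ] F)) +
    g z • (β z.1.1).compContinuousLinearMap jetBaseCoord

variable {β : B → B [⋀^Fin m]→L[ℝ] ℝ} {g : JetModel B F → ℝ} {z : JetModel B F}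

theorem cartanFormCoord_apply (v : Fin m → JetModel B F) :
    cartanFormCoord β g z v =
      ∑ k, fderiv ℝ g z (0, ((β z.1.1).toContinuousLinearMap (jetBaseCoord ∘ v) k).smulRight
        (contactForm z (v k))) + g z * β z.1.1 (jetBaseCoord ∘ v) := rfl

theorem cartanFormCoord_eq_of_base_eq_zero {v : Fin m → JetModel B F} {k : Fin m}
    (hk : (v k).1.1 = 0) :
    cartanFormCoord β g z v = fderiv ℝ g z
      (0, ((β z.1.1).toContinuousLinearMap (jetBaseCoord ∘ v) k).smulRight (v k).1.2) := by
  have hk' : jetBaseCoord (v k) = 0 := hk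
  change insertionForm _ _ _ _ v + g z * β z.1.1 (jetBaseCoord ∘ v) = _
  rw [(β z.1.1).map_coord_zero k hk', mul_zero, add_zero,
    insertionForm_eq_of_apply_eq_zero _ _ _ hk', contactForm_apply, hk, map_zero, sub_zero]
  rfl

theorem cartanFormCoord_eq_zero {v : Fin m → JetModel B F} {k : Fin m} (hk : (v k).1 = 0) :
    cartanFormCoord β g z v = 0 := by
  rw [cartanFormCoord_eq_of_base_eq_zero (congrArg Prod.fst hk), hk]
  have hzero : ((β z.1.1).toContinuousLinearMap (jetBaseCoord ∘ v) k).smulRight (0 : F) = 0 := by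
    ext X
    exact smul_zero _
  exact (congrArg (fun χ => fderiv ℝ g z (0, χ)) hzero).trans (map_zero (fderiv ℝ g z))

theorem differentiableAt_cartanFormCoord_apply (hβ : DifferentiableAt ℝ β z.1.1)
    (hg : ContDiffAt ℝ ∞ g z) (v : Fin m → JetModel B F) :
    DifferentiableAt ℝ (fun z => cartanFormCoord β g z v) z := by
  have hβfst : DifferentiableAt ℝ (fun z : JetModel B F => β z.1.1) z :=
    DifferentiableAt.comp (f := fun z : JetModel B F => z.1.1) z hβ differentiableAt_fst.fst
  have hdg : DifferentiableAt ℝ (fderiv ℝ g) z :=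
    (hg.fderiv_right (m := 1) (by norm_cast)).differentiableAt (by simp)
  have hcontact (k : Fin m) :
      DifferentiableAt ℝ (fun z : JetModel B F => contactForm z (v k)) z := by
    simp only [contactForm_apply]
    exact (differentiableAt_const _).sub (differentiableAt_snd.clm_apply (differentiableAt_const _))
  have hslot (k : Fin m) := differentiableAt_alternating_toContinuousLinearMap hβfst
    (jetBaseCoord ∘ v) k
  simp only [cartanFormCoord_apply]
  exact (DifferentiableAt.fun_sum fun k _ => hdg.clm_apply ((differentiableAt_const _).prodMk
      (((ContinuousLinearMap.smulRightL ℝ B F).differentiableAt.comp z (hslot k)).clm_apply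
        (hcontact k)))).add
    ((hg.differentiableAt (by simp)).mul
      (hβfst.continuousAlternatingMap_apply fun _ => differentiableAt_const _))

theorem differentiableAt_cartanFormCoord [FiniteDimensional ℝ F] (hβ : DifferentiableAt ℝ β z.1.1)
    (hg : ContDiffAt ℝ ∞ g z) : DifferentiableAt ℝ (cartanFormCoord β g) z :=
  differentiableAt_continuousAlternatingMap_of_apply
    (differentiableAt_cartanFormCoord_apply hβ hg)

theorem extDeriv_cartanFormCoord_cons [FiniteDimensional ℝ F] (hβ : DifferentiableAt ℝ β z.1.1)
    (hg : ContDiffAt ℝ ∞ g z) (q : B →L[ℝ] F) {v : Fin m → JetModel B F} {k : Fin m}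
    (hk : (v k).1.1 = 0) :
    extDeriv (cartanFormCoord β g) z (Fin.cons ((0, q) : JetModel B F) v) =
      fderiv ℝ (fderiv ℝ g) z (0, q)
        (0, ((β z.1.1).toContinuousLinearMap (jetBaseCoord ∘ v) k).smulRight (v k).1.2) := by
  have hω := differentiableAt_cartanFormCoord hβ hg
  have hdg : DifferentiableAt ℝ (fderiv ℝ g) z :=
    (hg.fderiv_right (m := 1) (by norm_cast)).differentiableAt (by simp)
  rw [extDeriv_cons_of_eventually_eq_zero hω
    (.of_forall fun y w l hl => cartanFormCoord_eq_zero (by rw [hl]))]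
  set χ := ((β z.1.1).toContinuousLinearMap (jetBaseCoord ∘ v) k).smulRight (v k).1.2
  have hdiff : DifferentiableAt ℝ (fun y => cartanFormCoord β g y v) z :=
    differentiableAt_cartanFormCoord_apply hβ hg v
  have hderiv : HasLineDerivAt ℝ (fun y => fderiv ℝ g y (0, χ))
      (fderiv ℝ (fderiv ℝ g) z (0, q) (0, χ)) z (0, q) := by
    simpa using (hdg.hasFDerivAt.clm_apply
      (hasFDerivAt_const ((0, χ) : JetModel B F) z)).hasLineDerivAt (0, q)
  -- The form `β` is constant along the line through `z` in the direction `(0, q)`.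
  have hline : (fun t : ℝ => cartanFormCoord β g (z + t • (0, q)) v) =
      fun t : ℝ => fderiv ℝ g (z + t • (0, q)) (0, χ) := by
    funext t
    have hbase : (z + t • ((0, q) : JetModel B F)).1.1 = z.1.1 := by simp
    rw [cartanFormCoord_eq_of_base_eq_zero hk, hbase]
  rw [← hdiff.lineDeriv_eq_fderiv, lineDeriv, hline]
  exact HasDerivAt.deriv hderiv

end CartanFormInCoordinates

section CartanForm

variable {B F M E : Type*}
  [NormedAddCommGroup B] [NormedSpace ℝ B]
  [NormedAddCommGroup F] [NormedSpace ℝ F]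
  [TopologicalSpace M] [ChartedSpace B M] [IsManifold 𝓘(ℝ, B) ∞ M]
  [TopologicalSpace E] [ChartedSpace (B × F) E] [IsManifold 𝓘(ℝ, B × F) ∞ E]
  {π : SmoothBundle B F M E} {m : ℕ} {η : DiffForm B M m} {L : FirstJet π → ℝ}
  {j₀ j : FirstJet π}

theorem inChart_base_eq (η : DiffForm B M m) (hj : j ∈ (chartAt (JetModel B F) j₀).source) :
    η.inChart j₀.adaptedChart.base (chartAt (JetModel B F) j₀ j).1.1 =
      (η.valueAt j.projBase).compContinuousLinearMap
        (j₀.adaptedChart.dBaseSymm (j₀.adaptedChart.base j.projBase)) := by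
  have hbase : (chartAt (JetModel B F) j₀ j).1.1 = j₀.adaptedChart.base j.projBase :=
    (j₀.adaptedChart.base_proj _ hj).symm
  rw [hbase]
  ext v
  exact η.apply_congr (j₀.adaptedChart.base.left_inv (j₀.adaptedChart.proj_mem _ hj)) _

theorem FirstJet.dProjBase_eq_comp (hj : j ∈ (chartAt (JetModel B F) j₀).source) :
    j.dProjBase = j₀.adaptedChart.dBaseSymm (j₀.adaptedChart.base j.projBase) ∘L
      jetBaseCoord ∘L FirstJet.dChart j₀ j :=
  ContinuousLinearMap.ext fun w => FirstJet.dProjBase_eq_dBaseSymm hj w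

variable [FiniteDimensional ℝ B]

theorem FirstJet.verticalCoord_comp_structureForm (hj : j ∈ (chartAt (JetModel B F) j₀).source) :
    j₀.adaptedChart.verticalCoord j.pt ∘L j.structureForm =
      contactForm (chartAt (JetModel B F) j₀ j) ∘L FirstJet.dChart j₀ j :=
  ContinuousLinearMap.ext fun w => FirstJet.verticalCoord_structureForm hj w

/-- The coordinate expression of the Cartan form of `L` in the preferred chart of `J¹π` at `j₀`. -/
def cartanFormInChart (η : DiffForm B M m) (L : FirstJet π → ℝ) (j₀ : FirstJet π) :
    JetModel B F → JetModel B F [⋀^Fin m]→L[ℝ] ℝ :=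
  cartanFormCoord (η.inChart j₀.adaptedChart.base) (lagrangianInChart L j₀)

theorem cartanForm_eq_compContinuousLinearMap (η : DiffForm B M m)
    (hL : ContMDiff 𝓘(ℝ, JetModel B F) 𝓘(ℝ, ℝ) ∞ L)
    (hj : j ∈ (chartAt (JetModel B F) j₀).source) :
    cartanForm η L j = (cartanFormInChart η L j₀
      (chartAt (JetModel B F) j₀ j)).compContinuousLinearMap (FirstJet.dChart j₀ j) := by
  set z := chartAt (JetModel B F) j₀ j
  have hinsertion : insertionForm (η.valueAt j.projBase) j.dProjBase
        j.structureForm (verticalDeriv L j) =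
      insertionForm (η.inChart j₀.adaptedChart.base z.1.1) (jetBaseCoord ∘L FirstJet.dChart j₀ j)
        (contactForm z ∘L FirstJet.dChart j₀ j)
        (fderiv ℝ (lagrangianInChart L j₀) z ∘L
          ContinuousLinearMap.inr ℝ (B × F) (B →L[ℝ] F)) := by
    rw [inChart_base_eq η hj, ← FirstJet.verticalCoord_comp_structureForm hj,
      FirstJet.dProjBase_eq_comp hj]
    exact insertionForm_comp_of_apply_eq _ _ _ _
      (DFunLike.congr_fun (verticalDeriv_eq hL hj))
  have hdensity : lagrangianDensity η L j = lagrangianInChart L j₀ z •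
      (η.inChart j₀.adaptedChart.base z.1.1).compContinuousLinearMap
        (jetBaseCoord ∘L FirstJet.dChart j₀ j) := by
    have hLj : lagrangianInChart L j₀ z = L j :=
      congrArg L ((chartAt (JetModel B F) j₀).left_inv hj)
    rw [hLj, inChart_base_eq η hj, lagrangianDensity, FirstJet.dProjBase_eq_comp hj]
    rfl
  exact congrArg₂ (· + ·) hinsertion hdensity

theorem inChart_cartanForm_eq (η : DiffForm B M m) (hL : ContMDiff 𝓘(ℝ, JetModel B F) 𝓘(ℝ, ℝ) ∞ L)
    {z : JetModel B F} (hz : z ∈ (chartAt (JetModel B F) j₀).target) :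
    (cartanForm η L).inChart (chartAt (JetModel B F) j₀) z = cartanFormInChart η L j₀ z := by
  ext v
  have h := DFunLike.congr_fun
    (cartanForm_eq_compContinuousLinearMap η hL ((chartAt (JetModel B F) j₀).map_target hz))
    fun i => FirstJet.dChartSymm j₀ z (v i)
  rw [(chartAt (JetModel B F) j₀).right_inv hz] at h
  refine h.trans (congrArg (cartanFormInChart η L j₀ z) (funext fun i => ?_))
  exact FirstJet.dChart_dChartSymm hz (v i)

/-- The vertical lift at `j` of an element of the vector space `Hom(T_{π u}M, V_uπ)` on which
`J¹_uπ` is modelled: the initial velocity of the affine line through `j` in its direction. -/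
def FirstJet.vertLift (j : FirstJet π) : (B →L[ℝ] π.vertical j.pt) →L[ℝ] JetModel B F :=
  mfderiv 𝓘(ℝ, B →L[ℝ] π.vertical j.pt) 𝓘(ℝ, JetModel B F) j.translate 0

theorem FirstJet.dChart_vertLift (hj : j ∈ (chartAt (JetModel B F) j₀).source)
    (φ : B →L[ℝ] π.vertical j.pt) :
    FirstJet.dChart j₀ j (j.vertLift φ) = (0, j₀.adaptedChart.vertCoord j.pt φ) := by
  set T := ContinuousLinearMap.inr ℝ (B × F) (B →L[ℝ] F) ∘L j₀.adaptedChart.vertCoord j.pt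
  have hmem (φ) : j.translate φ ∈ (chartAt (JetModel B F) j₀).source := hj
  have haff : HasFDerivAt (fun φ => chartAt (JetModel B F) j₀ j + T φ) T 0 :=
    T.hasFDerivAt.const_add _
  have hchart : chartAt (JetModel B F) j₀ ∘ j.translate =
      fun φ => chartAt (JetModel B F) j₀ j + T φ :=
    funext fun φ => FirstJet.chartAt_translate j₀ j φ
  have htranslate : j.translate = (chartAt (JetModel B F) j₀).symm ∘
      fun φ => chartAt (JetModel B F) j₀ j + T φ := by
    funext φ
    rw [← hchart]
    exact ((chartAt (JetModel B F) j₀).left_inv (hmem φ)).symm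
  have hdiff : MDifferentiableAt 𝓘(ℝ, B →L[ℝ] π.vertical j.pt) 𝓘(ℝ, JetModel B F)
      j.translate 0 := by
    rw [htranslate]
    refine MDifferentiableAt.comp 0 ?_ haff.differentiableAt.mdifferentiableAt
    rw [← congrFun hchart 0]
    exact (FirstJet.mdifferentiable_chartAt j₀).mdifferentiableAt_symm
      ((chartAt (JetModel B F) j₀).map_source (hmem 0))
  have hcomp := mfderiv_comp 0
    ((FirstJet.mdifferentiable_chartAt j₀).mdifferentiableAt (hmem 0)) hdiff
  rw [hchart, mfderiv_eq_fderiv, haff.fderiv] at hcomp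
  have h : T φ = FirstJet.dChart j₀ (j.translate 0) (j.vertLift φ) := DFunLike.congr_fun hcomp φ
  rw [FirstJet.translate_zero] at h
  exact h.symm

theorem FirstJet.exists_vertLift_eq {ξ : JetModel B F} (hξ : j.dPt ξ = 0) :
    ∃ φ, j.vertLift φ = ξ := by
  have hj := mem_chart_source (JetModel B F) j
  obtain ⟨φ, hφ⟩ := j.adaptedChart.vertCoord_surjective hj (FirstJet.dChart j j ξ).2
  refine ⟨φ, Function.LeftInverse.injective (FirstJet.dChartSymm_dChart hj) ?_⟩
  rw [FirstJet.dChart_vertLift hj, hφ]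
  exact Prod.ext (by rw [FirstJet.dChart_fst hj, hξ, map_zero]) rfl

theorem FirstJet.vertCoord_smulRight_structureForm (η : DiffForm B M m)
    (hj : j ∈ (chartAt (JetModel B F) j₀).source) {v : Fin m → JetModel B F} {k : Fin m}
    (hk : (FirstJet.dChart j₀ j (v k)).1.1 = 0) :
    j₀.adaptedChart.vertCoord j.pt (((η.valueAt j.projBase).toContinuousLinearMap
        (j.dProjBase ∘ v) k).smulRight (j.structureForm (v k))) =
      ((η.inChart j₀.adaptedChart.base
        (chartAt (JetModel B F) j₀ j).1.1).toContinuousLinearMap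
          (jetBaseCoord ∘ FirstJet.dChart j₀ j ∘ v) k).smulRight
            (FirstJet.dChart j₀ j (v k)).1.2 := by
  rw [inChart_base_eq η hj, compContinuousLinearMap_toContinuousLinearMap,
    FirstJet.dProjBase_eq_comp hj]
  ext X
  refine (map_smul (j₀.adaptedChart.verticalCoord j.pt) _ _).trans ?_
  rw [FirstJet.verticalCoord_structureForm hj, hk, map_zero, sub_zero]
  rfl

theorem multisymplecticCartanForm_cons (η : DiffForm B M m)
    (hL : ContMDiff 𝓘(ℝ, JetModel B F) 𝓘(ℝ, ℝ) ∞ L) (ξ : JetModel B F) (v : Fin m → JetModel B F) :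
    (multisymplecticCartanForm η L j : JetModel B F [⋀^Fin (m + 1)]→L[ℝ] ℝ) (Fin.cons ξ v) =
      -extDeriv (cartanFormInChart η L j) (chartAt (JetModel B F) j j)
        (Fin.cons (FirstJet.dChart j j ξ) (FirstJet.dChart j j ∘ v)) := by
  have hcartan : (cartanForm η L).inChart (chartAt (JetModel B F) j)
      =ᶠ[𝓝 (chartAt (JetModel B F) j j)] cartanFormInChart η L j := by
    filter_upwards [chart_target_mem_nhds (JetModel B F) j] with y hy
      using inChart_cartanForm_eq η hL hy
  rw [← hcartan.extDeriv_eq, ← Fin.comp_cons]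
  rfl

variable [FiniteDimensional ℝ F]

theorem multisymplecticCartanForm_vertLift_cons (hη : η.IsSmooth)
    (hL : ContMDiff 𝓘(ℝ, JetModel B F) 𝓘(ℝ, ℝ) ∞ L) (φ : B →L[ℝ] π.vertical j.pt)
    {v : Fin m → JetModel B F} {k : Fin m} (hk : j.dProjBase (v k) = 0) :
    (multisymplecticCartanForm η L j : JetModel B F [⋀^Fin (m + 1)]→L[ℝ] ℝ)
        (Fin.cons (j.vertLift φ) v) =
      -verticalHessian L j φ (((η.valueAt j.projBase).toContinuousLinearMap
        (j.dProjBase ∘ v) k).smulRight (j.structureForm (v k))) := by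
  have hj := mem_chart_source (JetModel B F) j
  have hbase : (chartAt (JetModel B F) j j).1.1 ∈ j.adaptedChart.base.target :=
    j.adaptedChart.base_proj _ hj ▸
      j.adaptedChart.base.map_source (j.adaptedChart.proj_mem _ hj)
  have hkbase : (FirstJet.dChart j j (v k)).1.1 = 0 := by
    rw [FirstJet.dChart_fst_fst hj, hk, map_zero]
  rw [multisymplecticCartanForm_cons η hL, FirstJet.dChart_vertLift hj, cartanFormInChart,
    extDeriv_cartanFormCoord_cons (hη.differentiableAt_inChart j.adaptedChart.base_mem hbase)
      (contDiffAt_lagrangianInChart hL (mem_chart_target _ j)) _ hkbase,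
    verticalHessian_apply hL hj, FirstJet.vertCoord_smulRight_structureForm η hj hkbase]
  rfl

section Nondegeneracy

variable {σ : B × F → JetModel B F}

theorem verticalHessian_coord_smulRight_eq_zero (hη : η.IsVolumeForm)
    (hL : ContMDiff 𝓘(ℝ, JetModel B F) 𝓘(ℝ, ℝ) ∞ L) {φ : B →L[ℝ] π.vertical j.pt}
    (hσ : ∀ a, j.dPt (σ a) = a)
    (hφ : ∀ a : Fin m → B × F,
      (multisymplecticCartanForm η L j : JetModel B F [⋀^Fin (m + 1)]→L[ℝ] ℝ)
        (Fin.cons (j.vertLift φ) (σ ∘ a)) = 0)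
    (b : Module.Basis (Fin m) ℝ B) (k : Fin m) (y : π.vertical j.pt) :
    verticalHessian L j φ ((b.coord k).toContinuousLinearMap.smulRight y) = 0 := by
  -- Contracting against horizontal lifts of `b`, the `k`-th one replaced by `y`, isolates
  -- the Hessian against `bᵏ ⊗ y`.
  let a : Fin m → B × F := Function.update (fun i => j.horMap (b i)) k y
  have hak : a k = y := Function.update_self ..
  have hai (i : Fin m) (hi : i ≠ k) : a i = j.horMap (b i) := Function.update_of_ne hi ..
  have hbase (i : Fin m) : j.dProjBase (σ (a i)) = π.dProj j.pt (a i) := by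
    rw [FirstJet.dProjBase_eq]
    exact congrArg (π.dProj j.pt) (hσ (a i))
  have hk : j.dProjBase (σ (a k)) = 0 := by
    rw [hbase, hak]
    exact y.2
  have hslot : (η.valueAt j.projBase).toContinuousLinearMap (j.dProjBase ∘ σ ∘ a) k =
      η.valueAt j.projBase b • (b.coord k).toContinuousLinearMap := by
    rw [← alternating_toContinuousLinearMap_basis]
    refine alternating_toContinuousLinearMap_congr _ fun i hi => (hbase i).trans ?_
    rw [hai i hi]
    exact j.dProj_horMap (b i)
  have hstructure : j.structureForm (σ (a k)) = y := by
    apply Subtype.ext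
    rw [FirstJet.coe_structureForm, hk, map_zero, sub_zero, hσ, hak]
  have hb : η.valueAt j.projBase b ≠ 0 :=
    ((η.valueAt j.projBase).toAlternatingMap.map_basis_ne_zero_iff b).2 fun h =>
      hη.2.2 j.projBase (ContinuousAlternatingMap.toAlternatingMap_injective h)
  have h := (multisymplecticCartanForm_vertLift_cons hη.2.1 hL φ (v := σ ∘ a) hk).symm.trans (hφ a)
  rw [neg_eq_zero, hslot, Function.comp_apply, hstructure] at h
  have hsmul : (η.valueAt j.projBase b • (b.coord k).toContinuousLinearMap).smulRight y =
      η.valueAt j.projBase b • (b.coord k).toContinuousLinearMap.smulRight y :=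
    ContinuousLinearMap.ext fun X => mul_smul (η.valueAt j.projBase b) (b.coord k X) y
  rw [hsmul, map_smul, smul_eq_zero] at h
  exact h.resolve_left hb

theorem eq_zero_of_forall_multisymplecticCartanForm_cons_eq_zero (hη : η.IsVolumeForm)
    (hL : ContMDiff 𝓘(ℝ, JetModel B F) 𝓘(ℝ, ℝ) ∞ L) (hreg : IsRegularLagrangian L)
    {ξ : JetModel B F} (hξ : j.dPt ξ = 0) (hσ : ∀ a, j.dPt (σ a) = a)
    (h : ∀ a : Fin m → B × F,
      (multisymplecticCartanForm η L j : JetModel B F [⋀^Fin (m + 1)]→L[ℝ] ℝ)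
        (Fin.cons ξ (σ ∘ a)) = 0) : ξ = 0 := by
  obtain ⟨φ, rfl⟩ := FirstJet.exists_vertLift_eq hξ
  let b : Module.Basis (Fin m) ℝ B := (Module.finBasis ℝ B).reindex (finCongr hη.1.symm)
  rw [hreg j φ fun χ => ?_, map_zero]
  rw [← sum_coord_smulRight b χ, map_sum]
  exact Finset.sum_eq_zero fun k _ => verticalHessian_coord_smulRight_eq_zero hη hL hσ h b k _

end Nondegeneracy

end CartanForm

section LagrangianSubspaces

variable {V : Type*} [NormedAddCommGroup V] [NormedSpace ℝ V] {l : ℕ}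
  {α : V [⋀^Fin (l + 1)]→L[ℝ] ℝ} {W : Submodule ℝ V}

theorem sub_mem_orthogonalComplement {w w' : V} (hw : w ∈ orthogonalComplement α W)
    (hw' : w' ∈ orthogonalComplement α W) : w - w' ∈ orthogonalComplement α W := by
  intro v hv
  have hadd : α (Fin.cons (w - w' + w') v) = α (Fin.cons (w - w') v) + α (Fin.cons w' v) :=
    α.toMultilinearMap.cons_add v (w - w') w'
  rw [sub_add_cancel, hw v hv, hw' v hv, add_zero] at hadd
  exact hadd.symm

end LagrangianSubspaces

section JetFields

variable {B F M E : Type*}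
  [NormedAddCommGroup B] [NormedSpace ℝ B]
  [NormedAddCommGroup F] [NormedSpace ℝ F]
  [TopologicalSpace M] [ChartedSpace B M] [IsManifold 𝓘(ℝ, B) ∞ M]
  [TopologicalSpace E] [ChartedSpace (B × F) E] [IsManifold 𝓘(ℝ, B × F) ∞ E]
  {π : SmoothBundle B F M E}

namespace JetField

variable (Ψ : JetField π)

theorem mdifferentiableAt (u : E) :
    MDifferentiableAt 𝓘(ℝ, B × F) 𝓘(ℝ, JetModel B F) Ψ.toFun u :=
  (Ψ.contMDiff u).mdifferentiableAt (by simp)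

theorem dPt_tangentMap (u : E) (v : B × F) : (Ψ.toFun u).dPt (Ψ.tangentMap u v) = v := by
  have hcomp := mfderiv_comp u (Ψ.toFun u).mdifferentiableAt_pt (Ψ.mdifferentiableAt u)
  rw [show FirstJet.pt ∘ Ψ.toFun = id from funext Ψ.pt_toFun, mfderiv_id] at hcomp
  exact (DFunLike.congr_fun hcomp v).symm

theorem mem_range_iff {j : FirstJet π} : j ∈ Set.range Ψ.toFun ↔ Ψ.toFun j.pt = j :=
  ⟨fun ⟨u, hu⟩ => by rw [← hu, Ψ.pt_toFun], fun h => ⟨_, h⟩⟩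

-- A jet `j` and `Ψ j.pt` lie in a common chart, so they can be separated without assuming that
-- `J¹π` is Hausdorff.
theorem isClosed_range : IsClosed (Set.range Ψ.toFun) := by
  rw [← isOpen_compl_iff, isOpen_iff_mem_nhds]
  intro j hj
  rw [Set.mem_compl_iff, mem_range_iff] at hj
  set e := chartAt (JetModel B F) j
  have hjs : j ∈ e.source := mem_chart_source (JetModel B F) j
  have hΨjs : Ψ.toFun j.pt ∈ e.source := by
    rw [FirstJet.mem_chartAt_source] at hjs ⊢
    rwa [Ψ.pt_toFun]
  have hne : e (Ψ.toFun j.pt) ≠ e j := fun h =>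
    hj (FirstJet.eq_of_pt_eq_of_chartAt_eq hΨjs (Ψ.pt_toFun _) h)
  have hcont : ContinuousAt (fun i : FirstJet π => e (Ψ.toFun i.pt)) j :=
    ContinuousAt.comp (f := fun i : FirstJet π => Ψ.toFun i.pt) (e.continuousAt hΨjs)
      (Ψ.contMDiff.continuous.comp FirstJet.contMDiff_pt.continuous).continuousAt
  filter_upwards [(hcont.sub (e.continuousAt hjs)).eventually_ne (sub_ne_zero.2 hne)] with i hi hΨi
  exact hi (sub_eq_zero.2 (congrArg e (Ψ.mem_range_iff.1 hΨi)))

theorem range_tangentMap_subset_orthogonalComplement {l : ℕ}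
    {α : DiffForm (JetModel B F) (FirstJet π) (l + 1)} (hα : Ψ.pullback α = 0) (u : E) :
    ((Ψ.tangentMap u).range : Set (JetModel B F)) ⊆
      orthogonalComplement (α.valueAt (Ψ.toFun u)) (Ψ.tangentMap u).range := by
  rintro _ ⟨a, rfl⟩ v hv
  choose c hc using hv
  obtain rfl : Ψ.tangentMap u ∘ c = v := funext hc
  have hpullback : α.valueAt (Ψ.toFun u) (Ψ.tangentMap u ∘ Fin.cons a c) = 0 :=
    DFunLike.congr_fun (congrFun hα u) (Fin.cons a c : Fin (l + 1) → B × F)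
  rwa [Fin.comp_cons] at hpullback

theorem isLagrangianImage_multisymplecticCartanForm [FiniteDimensional ℝ B]
    [FiniteDimensional ℝ F] {m : ℕ} {η : DiffForm B M m} (hη : η.IsVolumeForm) {L : FirstJet π → ℝ}
    (hL : ContMDiff 𝓘(ℝ, JetModel B F) 𝓘(ℝ, ℝ) ∞ L) (hreg : IsRegularLagrangian L)
    (hΨ : Ψ.pullback (multisymplecticCartanForm η L) = 0) :
    Ψ.IsLagrangianImage (multisymplecticCartanForm η L) := by
  intro u
  have hisotropic := Ψ.range_tangentMap_subset_orthogonalComplement hΨ u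
  refine hisotropic.antisymm fun (w : JetModel B F) hw => ?_
  let w' : JetModel B F := Ψ.tangentMap u ((Ψ.toFun u).dPt w)
  have hvertical : (Ψ.toFun u).dPt (w - w') = 0 := by
    rw [map_sub, Ψ.dPt_tangentMap, sub_self]
  have horthogonal := sub_mem_orthogonalComplement hw (hisotropic ⟨(Ψ.toFun u).dPt w, rfl⟩)
  have hww' : w - w' = 0 :=
    eq_zero_of_forall_multisymplecticCartanForm_cons_eq_zero hη hL hreg hvertical
      (Ψ.dPt_tangentMap u) fun a => horthogonal _ fun i => ⟨a i, rfl⟩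
  exact ⟨(Ψ.toFun u).dPt w, (sub_eq_zero.1 hww').symm⟩

end JetField

end JetFields

section HolonomicDistributions

variable {B F M E : Type*}
  [NormedAddCommGroup B] [NormedSpace ℝ B]
  [NormedAddCommGroup F] [NormedSpace ℝ F]
  [TopologicalSpace M] [ChartedSpace B M] [TopologicalSpace E] [ChartedSpace (B × F) E]
  {π : SmoothBundle B F M E}

theorem FirstJet.eq_of_range_horMap_le {j j' : FirstJet π} (hpt : j.pt = j'.pt)
    (hrange : j'.horMap.range ≤ j.horMap.range) : j = j' := by
  refine FirstJet.ext_of_eq hpt (ContinuousLinearMap.ext fun (v : B) => ?_)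
  obtain ⟨w, hw : j.horMap w = j'.horMap v⟩ := hrange ⟨v, rfl⟩
  have hwv : w = v := calc
    w = π.dProj j.pt (j.horMap w) := (j.mfderiv_hor w).symm
    _ = π.dProj j'.pt (j'.horMap v) := by rw [hpt, hw]
    _ = v := j'.mfderiv_hor v
  rwa [hwv] at hw

variable [IsManifold 𝓘(ℝ, B) ∞ M] [IsManifold 𝓘(ℝ, B × F) ∞ E]
  {D : SubspaceField (JetModel B F) (FirstJet π)} {m : ℕ}

/-- A `k`-dimensional integrable distribution in `J¹π` whose integral sections are holonomic, that
is, prolongations `j¹φ` of sections of `π`: a solution of the Lagrangian problem, without the field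
equations. -/
structure IsHolonomicDistribution (D : SubspaceField (JetModel B F) (FirstJet π)) (k : ℕ) :
    Prop where
  isDistribution : D.IsDistribution k
  integrable : IsIntegrableDistribution B FirstJet.projBase D
  isProlongation : ∀ (U : Set M) (ψ : M → FirstJet π),
    IsIntegralSection B FirstJet.projBase D U ψ →
      ∃ (φ : M → E) (hφ : IsLocalSection B (B × F) π.proj U φ),
        ∀ x (hx : x ∈ U), ψ x = FirstJet.prolongation hφ hx

theorem IsLagrangianDistribution.isHolonomicDistribution [FiniteDimensional ℝ B]
    {η : DiffForm B M m} {L : FirstJet π → ℝ}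
    (hD : IsLagrangianDistribution η L D) : IsHolonomicDistribution D m :=
  ⟨hD.isDistribution, hD.integrable, hD.isProlongation⟩

namespace IsHolonomicDistribution

theorem disjoint_ker_dPt (hD : IsHolonomicDistribution D m) (j : FirstJet π) :
    Disjoint (D j) j.dPt.ker := by
  obtain ⟨U, ψ, hψ, x, hx, rfl⟩ := hD.integrable j
  refine (hψ.disjoint_ker_mfderiv hx
    ((FirstJet.contMDiff_projBase (ψ x)).mdifferentiableAt (by simp))).mono_right ?_
  change (ψ x).dPt.ker ≤ (ψ x).dProjBase.ker
  rw [FirstJet.dProjBase_eq]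
  exact LinearMap.ker_le_ker_comp _ _

-- An integral section `j¹φ` through `j` projects to `φ`, whose tangent spaces are horizontal.
theorem map_dPt (hD : IsHolonomicDistribution D m) (j : FirstJet π) :
    (D j).map j.dPt.toLinearMap = j.horMap.range := by
  obtain ⟨U, ψ, hψ, x, hx, rfl⟩ := hD.integrable j
  obtain ⟨φ, hφ, hψφ⟩ := hD.isProlongation U ψ hψ
  have hpt : FirstJet.pt ∘ ψ =ᶠ[𝓝 x] φ := by
    filter_upwards [hφ.isOpen.mem_nhds hx] with y hy
    exact congrArg FirstJet.pt (hψφ y hy)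
  have hhor : (ψ x).horMap = mfderiv 𝓘(ℝ, B) 𝓘(ℝ, B × F) (FirstJet.pt ∘ ψ) x := by
    rw [hpt.mfderiv_eq, hψφ x hx]
    rfl
  rw [hhor, mfderiv_comp x (ψ x).mdifferentiableAt_pt (hψ.1.mdifferentiableAt hx), ← hψ.2 x hx]
  exact (LinearMap.range_comp _ _).symm

end IsHolonomicDistribution

namespace JetField

variable {Ψ : JetField π}

theorem associated_eq_distribution (Ψ : JetField π) (hD : IsHolonomicDistribution D m) :
    Ψ.associated D = Ψ.distribution :=
  funext fun u => hD.map_dPt (Ψ.toFun u)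

theorem associated_isDistribution (Ψ : JetField π) (hD : IsHolonomicDistribution D m) :
    (Ψ.associated D).IsDistribution m :=
  hD.isDistribution.map_of_leftInverse FirstJet.contMDiff_pt Ψ.contMDiff Ψ.pt_toFun
    (fun u => hD.disjoint_ker_dPt (Ψ.toFun u)) fun _ => rfl

theorem toFun_eq_prolongation {U : Set M} {φ : M → E}
    (hφ : IsIntegralSection B π.proj Ψ.distribution U φ) {x : M} (hx : x ∈ U) :
    Ψ.toFun (φ x) = FirstJet.prolongation hφ.1 hx :=
  FirstJet.eq_of_range_horMap_le (Ψ.pt_toFun _) (hφ.2 x hx).le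

theorem isTangentToImage_of_forall_exists
    (h : ∀ u, ∃ U, ∃ γ : M → E, IsLocalSection B (B × F) π.proj U γ ∧
      IsIntegralSection B FirstJet.projBase D U (Ψ.toFun ∘ γ) ∧ ∃ x ∈ U, γ x = u) :
    Ψ.IsTangentToImage D := by
  intro u
  obtain ⟨U, γ, hγ, hΨγ, x, hx, rfl⟩ := h u
  refine (hΨγ.2 x hx).ge.trans ?_
  rw [mfderiv_comp x (Ψ.mdifferentiableAt (γ x)) (hγ.mdifferentiableAt hx)]
  exact LinearMap.range_comp_le_range _ _

theorem IsGeneralizedSolution.isTangentToImage (h : Ψ.IsGeneralizedSolution m D) :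
    Ψ.IsTangentToImage D :=
  isTangentToImage_of_forall_exists fun u =>
    let ⟨U, γ, hγ, hu⟩ := h.associated_integrable u
    ⟨U, γ, hγ.1, h.comp_isIntegralSection U γ hγ, hu⟩

namespace IsTangentToImage

theorem map_tangentMap_associated (hT : Ψ.IsTangentToImage D) (u : E) :
    (Ψ.associated D u).map (Ψ.tangentMap u).toLinearMap = D (Ψ.toFun u) := by
  have hfix (w : JetModel B F) (hw : w ∈ D (Ψ.toFun u)) :
      Ψ.tangentMap u ((Ψ.toFun u).dPt w) = w := by
    obtain ⟨v, rfl⟩ := hT u hw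
    exact congrArg (Ψ.tangentMap u) (Ψ.dPt_tangentMap u v)
  refine le_antisymm ?_ fun (w : JetModel B F) hw => ⟨_, ⟨w, hw, rfl⟩, hfix w hw⟩
  rintro _ ⟨_, ⟨w, hw, rfl⟩, rfl⟩
  exact (hfix w hw).symm ▸ hw

theorem comp_isIntegralSection (hT : Ψ.IsTangentToImage D) {U : Set M} {γ : M → E}
    (hγ : IsIntegralSection B π.proj (Ψ.associated D) U γ) :
    IsIntegralSection B FirstJet.projBase D U (Ψ.toFun ∘ γ) :=
  hγ.comp_left Ψ.contMDiff (fun u => congrArg π.proj (Ψ.pt_toFun u))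
    fun x _ => (hT.map_tangentMap_associated (γ x)).symm

theorem isGeneralizedSolution (hT : Ψ.IsTangentToImage D) (hD : IsHolonomicDistribution D m)
    (hint : Ψ.IsIntegrable) : Ψ.IsGeneralizedSolution m D where
  integrable := hint
  associated_isDistribution := Ψ.associated_isDistribution hD
  associated_integrable := by
    rw [Ψ.associated_eq_distribution hD]
    exact hint
  comp_isIntegralSection _ _ hγ := hT.comp_isIntegralSection hγ

theorem eventually_mem_range (hT : Ψ.IsTangentToImage D) (hD : D.IsDistribution m)
    (hint : IsIntegrableDistribution B π.proj (Ψ.associated D)) {U : Set M} {ψ : M → FirstJet π}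
    (hψ : IsIntegralSection B FirstJet.projBase D U ψ) {x : M} (hx : x ∈ U)
    (hψx : ψ x ∈ Set.range Ψ.toFun) : ∀ᶠ y in 𝓝 x, ψ y ∈ Set.range Ψ.toFun := by
  obtain ⟨u, hu⟩ := hψx
  obtain ⟨V, γ, hγ, y, hy, hyu⟩ := hint u
  have hyx : y = x := by
    rw [← hγ.1.proj_eq y hy, hyu, ← Ψ.pt_toFun u, hu]
    exact hψ.1.proj_eq x hx
  subst hyx
  have heq : ψ =ᶠ[𝓝 y] Ψ.toFun ∘ γ :=
    hψ.eventuallyEq (hT.comp_isIntegralSection hγ) FirstJet.contMDiff_projBase hD hx hy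
      (hu.symm.trans (congrArg Ψ.toFun hyu.symm))
  filter_upwards [heq] with z hz using ⟨γ z, hz.symm⟩

theorem mapsTo_range (hT : Ψ.IsTangentToImage D) (hD : D.IsDistribution m)
    (hint : IsIntegrableDistribution B π.proj (Ψ.associated D)) {U : Set M} {ψ : M → FirstJet π}
    (hψ : Ψ.IsIntegralSectionMeetingImage D U ψ) : Set.MapsTo ψ U (Set.range Ψ.toFun) := by
  obtain ⟨hU, hψ, x₀, hx₀, hψx₀⟩ := hψ
  have hopen : IsOpen (U ∩ ψ ⁻¹' Set.range Ψ.toFun) :=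
    isOpen_iff_mem_nhds.2 fun x hx => Filter.inter_mem (hψ.1.isOpen.mem_nhds hx.1)
      (hT.eventually_mem_range hD hint hψ hx.1 hx.2)
  have hopen_compl : IsOpen (U ∩ ψ ⁻¹' (Set.range Ψ.toFun)ᶜ) :=
    hψ.1.contMDiffOn.continuousOn.isOpen_inter_preimage hψ.1.isOpen Ψ.isClosed_range.isOpen_compl
  have hsubset : U ⊆ U ∩ ψ ⁻¹' Set.range Ψ.toFun :=
    hU.isPreconnected.subset_left_of_subset_union hopen hopen_compl
      (Set.disjoint_left.2 fun _ h h' => h'.2 h.2)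
      (fun x hx => (em (ψ x ∈ Set.range Ψ.toFun)).imp (⟨hx, ·⟩) (⟨hx, ·⟩)) ⟨x₀, hx₀, hx₀, hψx₀⟩
  exact fun x hx => (hsubset hx).2

theorem projectsOntoIntegralSections (hT : Ψ.IsTangentToImage D) (hD : D.IsDistribution m)
    (hint : IsIntegrableDistribution B π.proj (Ψ.associated D)) :
    Ψ.ProjectsOntoIntegralSections D := by
  refine ⟨fun U ψ hψ => ?_, fun U γ hU hγ => ?_⟩
  · refine hψ.2.1.comp_left FirstJet.contMDiff_pt (fun _ => rfl) fun x hx => ?_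
    rw [JetField.associated, Ψ.mem_range_iff.1 (hT.mapsTo_range hD hint hψ hx)]
    rfl
  · obtain ⟨x, hx⟩ := hU.nonempty
    exact ⟨Ψ.toFun ∘ γ, ⟨hU, hT.comp_isIntegralSection hγ, x, hx, γ x, rfl⟩,
      fun y _ => Ψ.pt_toFun (γ y)⟩

end IsTangentToImage

theorem ProjectsOntoIntegralSections.isTangentToImage
    (h : Ψ.ProjectsOntoIntegralSections D) (hD : IsHolonomicDistribution D m)
    (hint : Ψ.IsIntegrable) : Ψ.IsTangentToImage D := by
  have : LocallyConnectedSpace M := ChartedSpace.locallyConnectedSpace B M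
  refine isTangentToImage_of_forall_exists fun u => ?_
  obtain ⟨U, γ, hγ, x, hx, hγx⟩ := hint u
  obtain ⟨V, hVU, hV, hxV, hVconn⟩ :=
    locallyConnectedSpace_iff_subsets_isOpen_isConnected.1 this x U (hγ.1.isOpen.mem_nhds hx)
  have hγV := hγ.mono hV hVU
  obtain ⟨ψ, ⟨-, hψ, -⟩, hψγ⟩ := h.2 V γ hVconn (by rwa [Ψ.associated_eq_distribution hD])
  obtain ⟨φ, hφ, hψφ⟩ := hD.isProlongation V ψ hψ
  have hφγ : Set.EqOn φ γ V := fun y hy =>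
    (congrArg FirstJet.pt (hψφ y hy)).symm.trans (hψγ y hy)
  have hψΨ : Set.EqOn (Ψ.toFun ∘ γ) ψ V := fun y hy => by
    rw [Function.comp_apply, ← hφγ hy, toFun_eq_prolongation (hγV.congr hφγ) hy, hψφ y hy]
  exact ⟨V, γ, hγV.1, hψ.congr hψΨ, x, hxV, hγx⟩

end JetField

end HolonomicDistributions

end

theorem mainTheorem4_general {B F M E : Type*}
    [NormedAddCommGroup B] [NormedSpace ℝ B] [FiniteDimensional ℝ B]
    [NormedAddCommGroup F] [NormedSpace ℝ F] [FiniteDimensional ℝ F]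
    [TopologicalSpace M] [ChartedSpace B M] [IsManifold 𝓘(ℝ, B) ∞ M]
    [TopologicalSpace E] [ChartedSpace (B × F) E] [IsManifold 𝓘(ℝ, B × F) ∞ E]
    (π : SmoothBundle B F M E)
    (m : ℕ) (η : DiffForm B M m) (hη : η.IsVolumeForm)
    (L : FirstJet π → ℝ) (hL : ContMDiff 𝓘(ℝ, JetModel B F) 𝓘(ℝ, ℝ) ∞ L)
    (hreg : IsRegularLagrangian L)
    (D : SubspaceField (JetModel B F) (FirstJet π)) (hD : IsHolonomicDistribution D m)
    (Ψ : JetField π) (hint : Ψ.IsIntegrable)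
    (hΨ : Ψ.pullback (multisymplecticCartanForm η L) = 0) :
    List.TFAE [
      Ψ.IsSolution η L D,
      Ψ.IsLagrangianImage (multisymplecticCartanForm η L) ∧ Ψ.IsTangentToImage D,
      Ψ.ProjectsOntoIntegralSections D] := by
  tfae_have 1 → 2 := fun h =>
    ⟨Ψ.isLagrangianImage_multisymplecticCartanForm hη hL hreg hΨ, h.1.isTangentToImage⟩
  tfae_have 2 → 3 := fun h =>
    have hsol := h.2.isGeneralizedSolution hD hint
    h.2.projectsOntoIntegralSections hD.isDistribution hsol.associated_integrable
  tfae_have 3 → 1 := fun h => ⟨(h.isTangentToImage hD hint).isGeneralizedSolution hD hint, hΨ⟩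
  tfae_finish

theorem mainTheorem4 {B F M E : Type*}
    [NormedAddCommGroup B] [NormedSpace ℝ B] [FiniteDimensional ℝ B]
    [NormedAddCommGroup F] [NormedSpace ℝ F] [FiniteDimensional ℝ F]
    [TopologicalSpace M] [T2Space M] [SecondCountableTopology M]
    [ChartedSpace B M] [IsManifold 𝓘(ℝ, B) ∞ M]
    [TopologicalSpace E] [T2Space E] [SecondCountableTopology E]
    [ChartedSpace (B × F) E] [IsManifold 𝓘(ℝ, B × F) ∞ E]
    (π : SmoothBundle B F M E)
    (m : ℕ) (η : DiffForm B M m) (hη : η.IsVolumeForm)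
    (L : FirstJet π → ℝ) (hL : ContMDiff 𝓘(ℝ, JetModel B F) 𝓘(ℝ, ℝ) ∞ L)
    (hreg : IsRegularLagrangian L)
    (D : SubspaceField (JetModel B F) (FirstJet π)) (hD : IsLagrangianDistribution η L D)
    (Ψ : JetField π) (hint : Ψ.IsIntegrable)
    (hΨ : Ψ.pullback (multisymplecticCartanForm η L) = 0) :
    List.TFAE [
      Ψ.IsSolution η L D,
      Ψ.IsLagrangianImage (multisymplecticCartanForm η L) ∧ Ψ.IsTangentToImage D,
      Ψ.ProjectsOntoIntegralSections D] :=
  mainTheorem4_general π m η hη L hL hreg D hD.isHolonomicDistribution Ψ hint hΨ
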